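/- Let $m,l,r$ be nonnegative integers, $\rho\in(1,\infty)$, $q\in[1,\infty]$ and $p\in[1,\infty]$ with $1/p+1/q=1$. Let $W$ be a random vector in $\mathbb{R}^m$, let $W_1,W_2,\ldots$ be i.i.d. copies of $W$, and let $P_n$ be the empirical distribution of $W_1,\ldots,W_n$. Let $h:\mathbb{R}^m\times\mathbb{R}^l\to\mathbb{R}^r$ and $\theta_*\in\mathbb{R}^l$. For probability measures $P,Q$ on $\mathbb{R}^m$ put $$\mathcal{D}_c(P,Q)=\inf\{E_\pi\|U-V\|_q^\rho : \pi \text{ is a law of a pair } (U,V) \text{ on } \mathbb{R}^m\times\mathbb{R}^m \text{ with marginals } \pi_U=P,\ \pi_V=Q\},$$ and define the robust Wasserstein profile function by $$R_n(\theta;\rho)=\inf\{\mathcal{D}_c(P,P_n) : P \text{ a probability measure on } \mathbb{R}^m,\ h(\cdot,\theta) \text{ is } P\text{-integrable},\ E_P[h(\cdot,\theta)]=\mathbf{0}\}.$$ Let $D_wh(w,\theta_*)$ denote the $r\times m$ Jacobian matrix of $h(\cdot,\theta_*)$ at $w$; for matrices $\|\cdot\|_p$ is the norm induced by the vector $\ell_p$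 norms. Assume: - (A2) $E[h(W,\theta_*)]=\mathbf{0}$ and $E\|h(W,\theta_*)\|_2^2<\infty$. - (A3) $h(\cdot,\theta_*)$ is continuously differentiable. - (A4) For every $\zeta\in\mathbb{R}^r$ with $\zeta\neq 0$, $P(\|\zeta^TD_wh(W,\theta_*)\|_p>0)>0$. - (A5) There is $\kappa\in(0,\infty)$ with $\|D_wh(w,\theta_*)\|_p\le\kappa\|w\|_q^{\rho-1}$ whenever $\|w\|_q\ge 1$, and $E\|W\|_q^\rho<\infty$. - (A6) There is a measurable $\bar\kappa:\mathbb{R}^m\to[0,\infty)$ with $\|D_wh(w+\Delta,\theta_*)-D_wh(w,\theta_*)\|_p\le\bar\kappa(w)\|\Delta\|_q$ for all $w,\Delta\in\mathbb{R}^m$ with $\|\Delta\|_q\le 1$, and $E[\bar\kappa(W)^{\max\{2,\rho/(\rho-1)\}}]<\infty$. Then $R_n(\theta_*;\rho)<\infty$ for all $n\ge 1$, and, as $n\to\infty$, $$n^{\rho/2}R_n(\theta_*;\rho)\Rightarrow\bar R(\rho):=\max_{\zeta\in\mathbb{R}^r}\Big\{\rho\,\zeta^TH-(\rho-1)E\big\|\zeta^TD_wh(W,\theta_*)\big\|_p^{\rho/(\rho-1)}\Big\}$$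 in distribution, where $H\sim\mathcal{N}(\mathbf{0},E[h(W,\theta_*)h(W,\theta_*)^T])$; here the expectation $E\|\zeta^TD_wh(W,\theta_*)\|_p^{\rho/(\rho-1)}$ is finite for every $\zeta$, and the maximum is attained for every value of $H$. -/

import Mathlib

open MeasureTheory ProbabilityTheory Filter
open scoped ENNReal

namespace RWP

/-- The `ℓ_p` norm of a real vector, `p ∈ [1, ∞]`. -/
noncomputable def vecNorm {k : ℕ} (p : ℝ≥0∞) (v : Fin k → ℝ) : ℝ :=
  ‖WithLp.toLp p v‖

/-- The matrix norm `‖A‖_p = sup_{v ≠ 0} ‖A v‖_p / ‖v‖_p` induced by the vector `ℓ_p` norms. -/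
noncomputable def matNorm {r m : ℕ} (p : ℝ≥0∞) [Fact (1 ≤ p)]
    (A : Matrix (Fin r) (Fin m) ℝ) : ℝ :=
  ‖LinearMap.toContinuousLinearMap (Matrix.toLpLin p p A)‖

/-- The Jacobian matrix at `w` of a map `g : ℝ^m → ℝ^r`, i.e. the `r × m` matrix of the partial
derivatives `∂ g_i / ∂ w_j`. -/
noncomputable def jacobian {m r : ℕ} (g : EuclideanSpace ℝ (Fin m) → EuclideanSpace ℝ (Fin r))
    (w : EuclideanSpace ℝ (Fin m)) : Matrix (Fin r) (Fin m) ℝ :=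
  Matrix.of fun i j => (fderiv ℝ g w (EuclideanSpace.single j 1)) i

/-- The transport cost `c(u, w) = ‖u - w‖_q ^ ρ`. -/
noncomputable def cost {m : ℕ} (q : ℝ≥0∞) (ρ : ℝ) (u w : EuclideanSpace ℝ (Fin m)) : ℝ :=
  vecNorm q (u - w).ofLp ^ ρ

/-- The optimal transport discrepancy
`D_c(P, Q) = inf {E_π [c(U, W)] : π_U = P, π_W = Q}` for `c(u, w) = ‖u - w‖_q ^ ρ`. -/
noncomputable def discrepancy {m : ℕ} (q : ℝ≥0∞) (ρ : ℝ)
    (P Q : Measure (EuclideanSpace ℝ (Fin m))) : ℝ≥0∞ :=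
  ⨅ (π : Measure (EuclideanSpace ℝ (Fin m) × EuclideanSpace ℝ (Fin m)))
    (_ : π.map Prod.fst = P) (_ : π.map Prod.snd = Q),
    ∫⁻ x, ENNReal.ofReal (cost q ρ x.1 x.2) ∂π

/-- The empirical distribution of the first `n` points of a sequence (used for `n ≥ 1`). -/
noncomputable def empirical {m : ℕ} (n : ℕ) (x : ℕ → EuclideanSpace ℝ (Fin m)) :
    Measure (EuclideanSpace ℝ (Fin m)) :=
  (n : ℝ≥0∞)⁻¹ • ∑ i ∈ Finset.range n, Measure.dirac (x i)

/-- The robust Wasserstein profile function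
`R_n(θ; ρ) = inf {D_c(P, P_n) : P a probability measure, E_P [h(W, θ)] = 0}`, with values in
`[0, ∞]`, where `P_n` is the empirical distribution of `x 0, …, x (n - 1)`. -/
noncomputable def profile {m l r : ℕ} (q : ℝ≥0∞) (ρ : ℝ)
    (h : EuclideanSpace ℝ (Fin m) → EuclideanSpace ℝ (Fin l) → EuclideanSpace ℝ (Fin r))
    (n : ℕ) (x : ℕ → EuclideanSpace ℝ (Fin m)) (θ : EuclideanSpace ℝ (Fin l)) : ℝ≥0∞ :=
  ⨅ (P : Measure (EuclideanSpace ℝ (Fin m))) (_ : IsProbabilityMeasure P)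
    (_ : Integrable (fun w => h w θ) P) (_ : ∫ w, h w θ ∂P = 0),
    discrepancy q ρ P (empirical n x)

/-- The function of `ζ` maximised in the limit:
`ρ ζᵀ x - (ρ - 1) E ‖ζᵀ D g(W)‖_p ^ (ρ / (ρ - 1))`. -/
noncomputable def limitObjective {m r : ℕ} {Ω₀ : Type*} [MeasurableSpace Ω₀] (p : ℝ≥0∞) (ρ : ℝ)
    (g : EuclideanSpace ℝ (Fin m) → EuclideanSpace ℝ (Fin r))
    (μ₀ : Measure Ω₀) (W : Ω₀ → EuclideanSpace ℝ (Fin m))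
    (x : EuclideanSpace ℝ (Fin r)) (ζ : Fin r → ℝ) : ℝ :=
  ρ * (ζ ⬝ᵥ x.ofLp)
    - (ρ - 1) * ∫ ω, vecNorm p (Matrix.vecMul ζ (jacobian g (W ω))) ^ (ρ / (ρ - 1)) ∂μ₀

/-- `R̄(ρ)` as a function of the value `x` of the Gaussian vector `H`: the maximum over `ζ` of
`limitObjective`. -/
noncomputable def limitValue {m r : ℕ} {Ω₀ : Type*} [MeasurableSpace Ω₀] (p : ℝ≥0∞) (ρ : ℝ)
    (g : EuclideanSpace ℝ (Fin m) → EuclideanSpace ℝ (Fin r))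
    (μ₀ : Measure Ω₀) (W : Ω₀ → EuclideanSpace ℝ (Fin m))
    (x : EuclideanSpace ℝ (Fin r)) : ℝ :=
  ⨆ ζ : Fin r → ℝ, limitObjective p ρ g μ₀ W x ζ

/-- The matrix `E [g(W) g(W)ᵀ]`. -/
noncomputable def secondMoment {m r : ℕ} {Ω₀ : Type*} [MeasurableSpace Ω₀]
    (g : EuclideanSpace ℝ (Fin m) → EuclideanSpace ℝ (Fin r))
    (μ₀ : Measure Ω₀) (W : Ω₀ → EuclideanSpace ℝ (Fin m)) : Matrix (Fin r) (Fin r) ℝ :=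
  Matrix.of fun i j => ∫ ω, g (W ω) i * g (W ω) j ∂μ₀

end RWP

/-! Let `ν` be the law of `W`, `D` the derivative of `h(·, θ)` and `H_n = n^(-1/2) ∑ h(X_i, θ)`.
Moving each observation `w` by `-n^(-1/2) δ(w)`, for a bounded field `δ`, changes `H_n` by about `-∫
D δ dν` and costs about `n^(-ρ/2) ∫ ‖δ‖_q^ρ dν`. Hence `n^(ρ/2) R_n` should behave like `G(H_n)`,
where `G(x)` is the least value of `∫ ‖δ‖_q^ρ dν` under `∫ D δ dν = x`.

`G` is the value of a convex problem with finitely many linear constraints. Nondegeneracy makes the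
constraint map onto, so `G` is finite, convex and therefore continuous. Its Lagrangian dual is
computed pointwise by Hölder and Young and is exactly the maximum defining the limit, with an
attained maximiser (`strong_duality`).

The comparison of `n^(ρ/2) R_n` with `G(H_n)` holds almost surely for large `n`, as long as `H_n`
stays in a compact set (`eventually_profile_close`). For the lower bound, every linear functional
gives a weak dual bound on `R_n`; the inner optimisation at each observation is controlled by an
integrable envelope, averaged by the strong law, whose mean is close to the dual cost
(`eventually_profile_ge`). For the upper bound, the constraint must be solved exactly although `h`
is nonlinear. A transport plan may randomise, so it suffices that finitely many perturbed means
surround the origin; this survives small errors by convexity alone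
(`mem_convexHull_of_perturbation`, `eventually_profile_le`).

The central limit theorem for `H_n`, continuity of `G` and tightness then give the weak limit
(`tendstoInDistribution_of_eventually_close`). -/

namespace RWP

open Set Topology

set_option linter.unusedSectionVars false

/-! ### Convex problems with finitely many linear constraints. -/

section ValueFunction

variable {V F : Type*} [AddCommGroup V] [Module ℝ V] [NormedAddCommGroup F] [NormedSpace ℝ F]

/-- The value function `x ↦ inf {c v : T v = x}` of a linearly constrained minimisation problem. -/
noncomputable def valueFunction (T : V →ₗ[ℝ] F) (c : V → ℝ) (x : F) : ℝ :=
  sInf (c '' {v | T v = x})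

variable {T : V →ₗ[ℝ] F} {c : V → ℝ}

lemma valueFunction_le (hc0 : ∀ v, 0 ≤ c v) (v : V) : valueFunction T c (T v) ≤ c v :=
  csInf_le ⟨0, by rintro _ ⟨v, -, rfl⟩; exact hc0 v⟩ ⟨v, rfl, rfl⟩

lemma exists_lt_of_valueFunction_lt (hT : Function.Surjective T) {x : F} {s : ℝ}
    (h : valueFunction T c x < s) : ∃ v, T v = x ∧ c v < s := by
  obtain ⟨v, hv⟩ := hT x
  obtain ⟨_, ⟨w, hw, rfl⟩, hlt⟩ := exists_lt_of_csInf_lt ⟨c v, mem_image_of_mem c hv⟩ h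
  exact ⟨w, hw, hlt⟩

lemma le_valueFunction (hT : Function.Surjective T) {x : F} {s : ℝ}
    (h : ∀ v, T v = x → s ≤ c v) : s ≤ valueFunction T c x := by
  by_contra! hlt
  obtain ⟨v, hv, hlt⟩ := exists_lt_of_valueFunction_lt hT hlt
  exact absurd (h v hv) hlt.not_ge

/-- Mixing near-minimisers for two points is feasible for the mixed point, by linearity of `T`.
Minimisers need not exist, hence the slack `ε`. -/
lemma convexOn_valueFunction (hT : Function.Surjective T) (hc0 : ∀ v, 0 ≤ c v)
    (hc : ConvexOn ℝ univ c) : ConvexOn ℝ univ (valueFunction T c) := by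
  refine ⟨convex_univ, fun x _ y _ a b ha hb hab => ?_⟩
  refine le_of_forall_pos_le_add fun ε hε => ?_
  obtain ⟨v, rfl, hv⟩ := exists_lt_of_valueFunction_lt hT (lt_add_of_pos_right (valueFunction T c x) hε)
  obtain ⟨w, rfl, hw⟩ := exists_lt_of_valueFunction_lt hT (lt_add_of_pos_right (valueFunction T c y) hε)
  have h1 := valueFunction_le (T := T) hc0 (a • v + b • w)
  have h2 := hc.2 (mem_univ v) (mem_univ w) ha hb hab
  simp only [map_add, map_smul, smul_eq_mul] at *
  have e : ε = a * ε + b * ε := by rw [← add_mul, hab, one_mul]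
  nlinarith [mul_le_mul_of_nonneg_left hv.le ha, mul_le_mul_of_nonneg_left hw.le hb]

variable [FiniteDimensional ℝ F]

lemma continuous_valueFunction (hT : Function.Surjective T) (hc0 : ∀ v, 0 ≤ c v)
    (hc : ConvexOn ℝ univ c) : Continuous (valueFunction T c) :=
  continuousOn_univ.1 ((convexOn_valueFunction hT hc0 hc).continuousOn isOpen_univ)

/-- A subgradient of the value function at `x`, obtained by separating its graph point from the open
strict epigraph. It acts as a Lagrange multiplier for the constraint `T v = x`. -/
lemma exists_dual_certificate (hT : Function.Surjective T) (hc0 : ∀ v, 0 ≤ c v)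
    (hc : ConvexOn ℝ univ c) (x : F) :
    ∃ ℓ : F →L[ℝ] ℝ, ∀ v, valueFunction T c x + ℓ (T v - x) ≤ c v := by
  have hconv := convexOn_valueFunction hT hc0 hc
  have hcont := continuous_valueFunction hT hc0 hc
  set L := valueFunction T c with hL
  have hopen : IsOpen {z : F × ℝ | L z.1 < z.2} :=
    isOpen_lt (hcont.comp continuous_fst) continuous_snd
  have hcvx : Convex ℝ {z : F × ℝ | L z.1 < z.2} := by
    simpa using hconv.convex_strict_epigraph
  obtain ⟨f, hf⟩ := geometric_hahn_banach_point_open (x := (x, L x)) hcvx hopen (by simp)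
  set τ : ℝ := f (0, 1) with hτ
  have hsplit : ∀ (y : F) (s : ℝ), f (y, s) = f (y, 0) + s * τ := by
    intro y s
    have : (y, s) = (y, (0 : ℝ)) + s • ((0 : F), (1 : ℝ)) := by simp
    rw [this, map_add, map_smul, smul_eq_mul]
  -- The separating hyperplane is not vertical, because the epigraph has a point directly above `(x,
  -- L x)`.
  have hτpos : 0 < τ := by
    have := hf (x, L x + 1) (by simp)
    rw [hsplit x (L x), hsplit x (L x + 1)] at this
    linarith
  have key : ∀ y, f (x, 0) + L x * τ ≤ f (y, 0) + L y * τ := by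
    intro y
    refine le_of_forall_pos_le_add fun ε hε => ?_
    have := hf (y, L y + ε / τ) (by simp; positivity)
    rw [hsplit x (L x), hsplit y, add_mul, div_mul_cancel₀ _ hτpos.ne'] at this
    linarith
  refine ⟨-(τ⁻¹ • f.comp (ContinuousLinearMap.inl ℝ F ℝ)), fun v => ?_⟩
  refine le_trans ?_ (valueFunction_le (T := T) hc0 v)
  have h1 := key (T v)
  have h2 : f (T v - x, 0) = f (T v, 0) - f (x, 0) := by
    rw [← map_sub]; simp
  simp only [neg_apply, smul_apply,
    ContinuousLinearMap.comp_apply, ContinuousLinearMap.inl_apply, smul_eq_mul, h2]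
  rw [← hL]
  have h3 : τ * L x ≤ τ * (L (T v) + τ⁻¹ * (f (T v, 0) - f (x, 0))) := by
    rw [mul_add, mul_inv_cancel_left₀ hτpos.ne']; linarith
  have := le_of_mul_le_mul_left h3 hτpos
  linarith

end ValueFunction

/-! ### Stability of convex hulls. -/

section Hull

variable {F : Type*} [NormedAddCommGroup F] [NormedSpace ℝ F] [FiniteDimensional ℝ F]

/-- A point well inside the convex hull of a finite family stays in the convex hull when the family
is slightly perturbed. -/
lemma mem_convexHull_of_perturbation {κ : Type*} [Finite κ] {x : F} {η : ℝ} (hη : 0 < η)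
    {y z : κ → F} (hy : Metric.closedBall x η ⊆ convexHull ℝ (range y))
    (hyz : ∀ k, ‖z k - y k‖ < η) : x ∈ convexHull ℝ (range z) := by
  by_contra hx
  obtain ⟨f, u, hxu, hf⟩ := geometric_hahn_banach_point_closed (convex_convexHull ℝ (range z))
    ((finite_range z).isCompact_convexHull ℝ).isClosed hx
  obtain ⟨v, hv1, hv2⟩ : ∃ v : F, ‖v‖ ≤ 1 ∧ f v = ‖f‖ := by
    obtain ⟨v, hv, hmax⟩ := (isCompact_closedBall (0 : F) 1).exists_isMaxOn
      ⟨0, by simp⟩ f.continuous.continuousOn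
    refine ⟨v, by simpa using hv, le_antisymm ?_ ?_⟩
    · have := f.le_opNorm v
      have h1 : ‖v‖ ≤ 1 := by simpa using hv
      calc f v ≤ ‖f v‖ := Real.le_norm_self _
        _ ≤ ‖f‖ * ‖v‖ := this
        _ ≤ ‖f‖ := mul_le_of_le_one_right (norm_nonneg _) h1
    · have hv0 : 0 ≤ f v := by simpa using hmax (show (0 : F) ∈ Metric.closedBall 0 1 by simp)
      refine ContinuousLinearMap.opNorm_le_of_unit_norm hv0 fun w hw => ?_
      rw [Real.norm_eq_abs, abs_le]
      have h1 := hmax (show w ∈ Metric.closedBall (0 : F) 1 by simp [hw])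
      have h2 := hmax (show -w ∈ Metric.closedBall (0 : F) 1 by simp [hw])
      simp only [mem_ofPred_eq, map_neg] at h1 h2
      exact ⟨by linarith, h1⟩
  -- This is the point of the ball where `f` is least. It lies in the hull of `y`, yet `f` is
  -- strictly larger at every `y k`.
  have hmem : x - η • v ∈ convexHull ℝ (range y) := hy (by
    simp only [Metric.mem_closedBall, dist_eq_norm, sub_sub_cancel_left, norm_neg, norm_smul,
      Real.norm_eq_abs, abs_of_pos hη]
    exact mul_le_of_le_one_right hη.le hv1)
  have hsub : convexHull ℝ (range y) ⊆ {w | f x - η * ‖f‖ < f w} := by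
    refine convexHull_min ?_ (convex_halfSpace_gt f.toLinearMap.isLinear _)
    rintro _ ⟨k, rfl⟩
    have h1 := hf _ (subset_convexHull ℝ _ (mem_range_self k))
    have h2 : f (z k) - f (y k) ≤ ‖f‖ * η := by
      rw [← map_sub]
      exact (Real.le_norm_self _).trans ((f.le_opNorm _).trans
        (mul_le_mul_of_nonneg_left (hyz k).le (norm_nonneg _)))
    simp only [mem_ofPred_eq]
    linarith
  have := hsub hmem
  simp only [mem_ofPred_eq, map_sub, map_smul, smul_eq_mul, hv2] at this
  exact lt_irrefl _ this

end Hull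

/-! ### Young's inequality. -/

section Young

lemma one_lt_dualExponent {ρ : ℝ} (hρ : 1 < ρ) : 1 < ρ / (ρ - 1) := by
  rw [lt_div_iff₀ (by linarith)]; linarith

/-- Young's inequality in the form `ρ a t ≤ t ^ ρ + (ρ - 1) a ^ (ρ / (ρ - 1))`. -/
lemma young_le {ρ a t : ℝ} (hρ : 1 < ρ) (ha : 0 ≤ a) (ht : 0 ≤ t) :
    ρ * (a * t) ≤ t ^ ρ + (ρ - 1) * a ^ (ρ / (ρ - 1)) := by
  have h := Real.young_inequality_of_nonneg ht ha (Real.HolderConjugate.conjExponent hρ)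
  rw [Real.conjExponent] at h
  have h2 : ρ * (t ^ ρ / ρ + a ^ (ρ / (ρ - 1)) / (ρ / (ρ - 1)))
      = t ^ ρ + (ρ - 1) * a ^ (ρ / (ρ - 1)) := by
    have : ρ - 1 ≠ 0 := by linarith
    field_simp
  rw [← h2, mul_comm a t]
  exact mul_le_mul_of_nonneg_left h (by linarith)

/-- The equality case of Young's inequality. -/
lemma young_eq {ρ a : ℝ} (hρ : 1 < ρ) (ha : 0 ≤ a) :
    ρ * (a * a ^ (1 / (ρ - 1))) = (a ^ (1 / (ρ - 1))) ^ ρ + (ρ - 1) * a ^ (ρ / (ρ - 1)) := by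
  have h1 : ρ - 1 ≠ 0 := by linarith
  have e1 : a * a ^ (1 / (ρ - 1)) = a ^ (ρ / (ρ - 1)) := by
    have : ρ / (ρ - 1) = 1 + 1 / (ρ - 1) := by field_simp; ring
    rw [this, Real.rpow_add' ha, Real.rpow_one]
    rw [← this]; have := one_lt_dualExponent hρ; linarith
  have e2 : (a ^ (1 / (ρ - 1))) ^ ρ = a ^ (ρ / (ρ - 1)) := by
    rw [← Real.rpow_mul ha]; congr 1; field_simp
  rw [e1, e2]; ring

/-- Young's inequality with a weight `θ` on the power of `t`. -/
lemma young_weighted {ρ a t θ : ℝ} (hρ : 1 < ρ) (ha : 0 ≤ a) (ht : 0 ≤ t) (hθ : 0 < θ) :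
    ρ * (a * t) ≤ θ * t ^ ρ + (ρ - 1) * ((θ ^ (1 / ρ))⁻¹ * a) ^ (ρ / (ρ - 1)) := by
  have hs : 0 < θ ^ (1 / ρ) := Real.rpow_pos_of_pos hθ _
  have h := young_le hρ (a := (θ ^ (1 / ρ))⁻¹ * a) (t := θ ^ (1 / ρ) * t) (by positivity)
    (by positivity)
  rw [Real.mul_rpow hs.le ht, ← Real.rpow_mul hθ.le, one_div_mul_cancel (by linarith),
    Real.rpow_one] at h
  convert h using 2
  field_simp

end Young

/-! ### Vector norms and Hölder duality. -/

section VecNorm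

variable {k : ℕ} (p q : ℝ≥0∞)

lemma vecNorm_nonneg [Fact (1 ≤ p)] (v : Fin k → ℝ) : 0 ≤ vecNorm p v := norm_nonneg _

lemma vecNorm_zero [Fact (1 ≤ p)] : vecNorm p (0 : Fin k → ℝ) = 0 := by
  simp [vecNorm]

lemma vecNorm_neg [Fact (1 ≤ p)] (v : Fin k → ℝ) : vecNorm p (-v) = vecNorm p v := by
  simp [vecNorm]

lemma vecNorm_add_le [Fact (1 ≤ p)] (v w : Fin k → ℝ) :
    vecNorm p (v + w) ≤ vecNorm p v + vecNorm p w := by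
  simpa [vecNorm] using norm_add_le (WithLp.toLp p v) (WithLp.toLp p w)

lemma vecNorm_smul [Fact (1 ≤ p)] (c : ℝ) (v : Fin k → ℝ) :
    vecNorm p (c • v) = |c| * vecNorm p v := by
  simp [vecNorm, norm_smul]

lemma vecNorm_top_eq (v : Fin k → ℝ) : vecNorm ∞ v = ⨆ i, |v i| := by
  simp [vecNorm, PiLp.norm_eq_ciSup]

lemma vecNorm_eq_sum (hp : 0 < p.toReal) (v : Fin k → ℝ) :
    vecNorm p v = (∑ i, |v i| ^ p.toReal) ^ (1 / p.toReal) := by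
  simp [vecNorm, PiLp.norm_eq_sum hp]

lemma vecNorm_one_eq (v : Fin k → ℝ) : vecNorm 1 v = ∑ i, |v i| := by
  rw [vecNorm_eq_sum 1 (by simp)]; simp

lemma continuous_vecNorm [Fact (1 ≤ p)] : Continuous (vecNorm p : (Fin k → ℝ) → ℝ) :=
  continuous_norm.comp (PiLp.continuous_toLp p _)

/-- The identity map as a continuous linear equivalence from Euclidean space to `ℓ_p`. -/
noncomputable def toLpEquiv (k : ℕ) [Fact (1 ≤ p)] :
    EuclideanSpace ℝ (Fin k) ≃L[ℝ] PiLp p (fun _ : Fin k => ℝ) :=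
  (PiLp.continuousLinearEquiv 2 ℝ _).trans (PiLp.continuousLinearEquiv p ℝ _).symm

lemma norm_toLpEquiv [Fact (1 ≤ p)] (v : EuclideanSpace ℝ (Fin k)) :
    ‖toLpEquiv p k v‖ = vecNorm p v.ofLp := rfl

lemma exists_vecNorm_le_norm (k : ℕ) [Fact (1 ≤ p)] :
    ∃ C : ℝ, 0 < C ∧ ∀ v : EuclideanSpace ℝ (Fin k), vecNorm p v.ofLp ≤ C * ‖v‖ := by
  obtain ⟨C, hC, h⟩ := (toLpEquiv p k).toContinuousLinearMap.bound
  exact ⟨C, hC, h⟩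

lemma exists_norm_le_vecNorm (k : ℕ) [Fact (1 ≤ p)] :
    ∃ C : ℝ, 0 < C ∧ ∀ v : EuclideanSpace ℝ (Fin k), ‖v‖ ≤ C * vecNorm p v.ofLp := by
  obtain ⟨C, hC, h⟩ := (toLpEquiv p k).symm.toContinuousLinearMap.bound
  exact ⟨C, hC, fun v => by simpa [norm_toLpEquiv] using h (toLpEquiv p k v)⟩

variable {p q}

/-- Separates the endpoints, where one norm is a sum and the other a maximum, from the range where
real exponents can be used. -/
lemma conjugate_cases (hpq : p⁻¹ + q⁻¹ = 1) :
    (p = 1 ∧ q = ∞) ∨ (p = ∞ ∧ q = 1) ∨ p.toReal.HolderConjugate q.toReal := by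
  by_cases hp : p = ∞
  · subst hp
    refine Or.inr (Or.inl ⟨rfl, ?_⟩)
    simpa using hpq
  by_cases hq : q = ∞
  · subst hq
    refine Or.inl ⟨?_, rfl⟩
    simpa using hpq
  refine Or.inr (Or.inr ?_)
  have h : ENNReal.HolderConjugate p q := ⟨by simpa using hpq⟩
  have hp1 : p ≠ 1 := by
    rintro rfl
    have : q⁻¹ = 0 := by
      rw [inv_one] at hpq
      exact (ENNReal.add_right_inj (by simp)).1 (hpq.trans (add_zero 1).symm)
    exact hq (by simpa using this)
  have hp' : 1 ≤ p := by
    rw [← ENNReal.inv_le_one, ← hpq]; exact le_self_add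
  have h1 : 1 < p.toReal := by
    have := ENNReal.toReal_strict_mono hp (lt_of_le_of_ne hp' (Ne.symm hp1))
    simpa using this
  rw [Real.holderConjugate_iff]
  refine ⟨h1, ?_⟩
  have h2 := congrArg ENNReal.toReal hpq
  have hq0 : q ≠ 0 := by rintro rfl; simp at hpq
  have hp0 : p ≠ 0 := by rintro rfl; simp at hpq
  rwa [ENNReal.toReal_add (by simpa using hp0) (by simpa using hq0), ENNReal.toReal_inv,
    ENNReal.toReal_inv, ENNReal.toReal_one] at h2

lemma dotProduct_le_of_top (a v : Fin k → ℝ) : a ⬝ᵥ v ≤ vecNorm ∞ a * vecNorm 1 v := by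
  rw [vecNorm_top_eq, vecNorm_one_eq, Finset.mul_sum, dotProduct]
  refine Finset.sum_le_sum fun i _ => ?_
  calc a i * v i ≤ |a i| * |v i| := by rw [← abs_mul]; exact le_abs_self _
    _ ≤ _ := mul_le_mul_of_nonneg_right (le_ciSup (f := fun i => |a i|) (Finite.bddAbove_range _) i)
      (abs_nonneg _)

/-- Hölder's inequality. -/
lemma dotProduct_le_vecNorm (hpq : p⁻¹ + q⁻¹ = 1) (a v : Fin k → ℝ) :
    a ⬝ᵥ v ≤ vecNorm p a * vecNorm q v := by
  rcases conjugate_cases hpq with ⟨rfl, rfl⟩ | ⟨rfl, rfl⟩ | h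
  · rw [dotProduct_comm, mul_comm]; exact dotProduct_le_of_top v a
  · exact dotProduct_le_of_top a v
  · rw [vecNorm_eq_sum p h.pos, vecNorm_eq_sum q h.symm.pos]
    exact Real.inner_le_Lp_mul_Lq _ _ _ h

/-- The equality case of Hölder's inequality: `ℓ_p` is the dual norm of `ℓ_q`. -/
lemma exists_dotProduct_eq_vecNorm (hpq : p⁻¹ + q⁻¹ = 1) (a : Fin k → ℝ) :
    ∃ v : Fin k → ℝ, vecNorm q v ≤ 1 ∧ a ⬝ᵥ v = vecNorm p a := by
  have hsign : ∀ x : ℝ, |(SignType.sign x : ℝ)| ≤ 1 := by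
    intro x
    rcases lt_trichotomy x 0 with h | h | h <;> simp [h]
  rcases conjugate_cases hpq with ⟨rfl, rfl⟩ | ⟨rfl, rfl⟩ | h
  · refine ⟨fun i => SignType.sign (a i), ?_, ?_⟩
    · rw [vecNorm_top_eq]
      exact Real.iSup_le (fun i => hsign _) zero_le_one
    · simp [vecNorm_one_eq, dotProduct]
  -- The extremiser is a signed unit vector at a coordinate of largest modulus; in dimension zero
  -- there is no such coordinate.
  · cases k with
    | zero => exact ⟨0, by simp [vecNorm_one_eq], by simp [vecNorm_top_eq]⟩
    | succ k =>
      obtain ⟨i, hi⟩ := Finite.exists_max fun i => |a i|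
      refine ⟨Pi.single i (SignType.sign (a i)), ?_, ?_⟩
      · rw [vecNorm_one_eq, Finset.sum_eq_single i (by intro j _ hj; simp [hj]) (by simp)]
        simpa using hsign (a i)
      · rw [vecNorm_top_eq, dotProduct_single, self_mul_sign]
        exact le_antisymm (le_ciSup (f := fun i => |a i|) (Finite.bddAbove_range _) i) (ciSup_le hi)
  -- The extremiser `g` for the moduli is nonnegative; restoring the signs of `a` turns the sum of
  -- moduli into the dot product.
  · obtain ⟨⟨g, hg, hg2⟩, -⟩ := NNReal.isGreatest_Lp Finset.univ (fun i => ‖a i‖₊) h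
    refine ⟨fun i => SignType.sign (a i) * (g i : ℝ), ?_, ?_⟩
    · rw [vecNorm_eq_sum q h.symm.pos]
      refine Real.rpow_le_one (Finset.sum_nonneg fun i _ => by positivity) ?_
        (by have := h.symm.pos; positivity)
      have hg' : ∑ i, (g i : ℝ) ^ q.toReal ≤ 1 := by exact_mod_cast hg
      refine le_trans (Finset.sum_le_sum fun i _ => ?_) hg'
      refine Real.rpow_le_rpow (abs_nonneg _) ?_ h.symm.pos.le
      rw [abs_mul, NNReal.abs_eq]
      exact mul_le_of_le_one_left (g i).2 (hsign _)
    · rw [vecNorm_eq_sum p h.pos]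
      have h3 := congrArg NNReal.toReal hg2
      push_cast at h3
      simp only [Real.norm_eq_abs] at h3
      rw [← h3, dotProduct]
      refine Finset.sum_congr rfl fun i _ => ?_
      rw [← mul_assoc, self_mul_sign]

end VecNorm

/-! ### Linear functionals, Jacobians and their norms. -/

section DualNorm

variable {m r : ℕ}

/-- The dual `ℓ_p` norm of a linear functional on Euclidean space. -/
noncomputable def dualNorm (p : ℝ≥0∞) (φ : EuclideanSpace ℝ (Fin m) →L[ℝ] ℝ) : ℝ :=
  vecNorm p fun j => φ (EuclideanSpace.single j 1)

lemma apply_eq_dotProduct (φ : EuclideanSpace ℝ (Fin m) →L[ℝ] ℝ) (v : EuclideanSpace ℝ (Fin m)) :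
    φ v = (fun j => φ (EuclideanSpace.single j 1)) ⬝ᵥ v.ofLp := by
  conv_lhs => rw [← (EuclideanSpace.basisFun (Fin m) ℝ).sum_repr v]
  simp [dotProduct, mul_comm]

variable {p q : ℝ≥0∞}

lemma dualNorm_nonneg [Fact (1 ≤ p)] (φ : EuclideanSpace ℝ (Fin m) →L[ℝ] ℝ) : 0 ≤ dualNorm p φ :=
  vecNorm_nonneg p _

lemma continuous_dualNorm [Fact (1 ≤ p)] :
    Continuous (dualNorm p : (EuclideanSpace ℝ (Fin m) →L[ℝ] ℝ) → ℝ) :=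
  (continuous_vecNorm p).comp (continuous_pi fun j => by fun_prop)

lemma le_dualNorm_mul (hpq : p⁻¹ + q⁻¹ = 1) (φ : EuclideanSpace ℝ (Fin m) →L[ℝ] ℝ)
    (v : EuclideanSpace ℝ (Fin m)) : φ v ≤ dualNorm p φ * vecNorm q v.ofLp := by
  rw [apply_eq_dotProduct]; exact dotProduct_le_vecNorm hpq _ _

lemma exists_eq_dualNorm (hpq : p⁻¹ + q⁻¹ = 1) (φ : EuclideanSpace ℝ (Fin m) →L[ℝ] ℝ) :
    ∃ v : EuclideanSpace ℝ (Fin m), vecNorm q v.ofLp ≤ 1 ∧ φ v = dualNorm p φ := by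
  obtain ⟨v, h1, h2⟩ := exists_dotProduct_eq_vecNorm hpq fun j => φ (EuclideanSpace.single j 1)
  exact ⟨WithLp.toLp 2 v, h1, by rw [apply_eq_dotProduct]; exact h2⟩

lemma exists_dualNorm_le_norm [Fact (1 ≤ p)] :
    ∃ C : ℝ, 0 < C ∧ ∀ φ : EuclideanSpace ℝ (Fin m) →L[ℝ] ℝ, dualNorm p φ ≤ C * ‖φ‖ := by
  let A : (EuclideanSpace ℝ (Fin m) →L[ℝ] ℝ) →ₗ[ℝ] PiLp p (fun _ : Fin m => ℝ) :=
    { toFun := fun φ => WithLp.toLp p fun j => φ (EuclideanSpace.single j 1)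
      map_add' := fun _ _ => rfl
      map_smul' := fun _ _ => rfl }
  obtain ⟨C, hC, h⟩ := (LinearMap.toContinuousLinearMap A).bound
  exact ⟨C, hC, h⟩

/-- The linear functional `y ↦ ζᵀ y`. -/
noncomputable def dotFunctional (ζ : Fin r → ℝ) : EuclideanSpace ℝ (Fin r) →L[ℝ] ℝ :=
  innerSL ℝ (WithLp.toLp 2 ζ)

lemma dotFunctional_apply (ζ : Fin r → ℝ) (y : EuclideanSpace ℝ (Fin r)) :
    dotFunctional ζ y = ζ ⬝ᵥ y.ofLp := by
  simp [dotFunctional, PiLp.inner_apply, dotProduct, mul_comm]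

lemma exists_eq_dotFunctional (ℓ : EuclideanSpace ℝ (Fin r) →L[ℝ] ℝ) :
    ∃ ζ : Fin r → ℝ, ℓ = dotFunctional ζ :=
  ⟨_, ContinuousLinearMap.ext fun y => (apply_eq_dotProduct ℓ y).trans
    (dotFunctional_apply _ y).symm⟩

/-- The dictionary between the coordinate-free functionals of the proof and the vectors `ζ` of the
theorem. -/
lemma dualNorm_dotFunctional_comp (p : ℝ≥0∞) (ζ : Fin r → ℝ)
    (g : EuclideanSpace ℝ (Fin m) → EuclideanSpace ℝ (Fin r)) (w : EuclideanSpace ℝ (Fin m)) :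
    dualNorm p ((dotFunctional ζ).comp (fderiv ℝ g w))
      = vecNorm p (Matrix.vecMul ζ (jacobian g w)) := by
  unfold dualNorm
  congr 1
  funext j
  simp only [ContinuousLinearMap.comp_apply, dotFunctional_apply, Matrix.vecMul, jacobian]
  rfl

/-- The operator norm of a derivative is controlled by the induced matrix norm of its Jacobian. -/
lemma exists_norm_le_matNorm [Fact (1 ≤ p)] :
    ∃ C : ℝ, 0 < C ∧ ∀ A : EuclideanSpace ℝ (Fin m) →L[ℝ] EuclideanSpace ℝ (Fin r),
      ‖A‖ ≤ C * matNorm p (Matrix.of fun i j => (A (EuclideanSpace.single j 1)) i) := by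
  obtain ⟨C₁, h₁, hC₁⟩ := exists_norm_le_vecNorm p r
  obtain ⟨C₂, h₂, hC₂⟩ := exists_vecNorm_le_norm p m
  refine ⟨C₁ * C₂, by positivity, fun A => ?_⟩
  set M : Matrix (Fin r) (Fin m) ℝ := Matrix.of fun i j => (A (EuclideanSpace.single j 1)) i with hM
  refine ContinuousLinearMap.opNorm_le_bound _ (mul_nonneg (by positivity) (norm_nonneg _))
    fun v => ?_
  have hA : (A v).ofLp = M.mulVec v.ofLp := by
    funext i
    have := apply_eq_dotProduct ((EuclideanSpace.proj i).comp A) v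
    simpa [Matrix.mulVec, hM] using this
  have h3 : vecNorm p (A v).ofLp ≤ matNorm p M * vecNorm p v.ofLp := by
    have := (LinearMap.toContinuousLinearMap (Matrix.toLpLin p p M)).le_opNorm
      (WithLp.toLp p v.ofLp)
    rw [hA]
    simpa [vecNorm, matNorm] using this
  calc ‖A v‖ ≤ C₁ * vecNorm p (A v).ofLp := hC₁ _
    _ ≤ C₁ * (matNorm p M * (C₂ * ‖v‖)) := by
      refine mul_le_mul_of_nonneg_left (h3.trans ?_) h₁.le
      exact mul_le_mul_of_nonneg_left (hC₂ v) (norm_nonneg _)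
    _ = _ := by ring

end DualNorm

/-! ### Duality for the population problem. -/

section PopulationDuality

variable {m r : ℕ}

/-- The space of bounded measurable perturbation fields. -/
def boundedFields (m : ℕ) :
    Submodule ℝ (EuclideanSpace ℝ (Fin m) → EuclideanSpace ℝ (Fin m)) where
  carrier := {δ | Measurable δ ∧ ∃ C : ℝ, ∀ w, ‖δ w‖ ≤ C}
  zero_mem' := ⟨measurable_const, 0, by simp⟩
  add_mem' := by
    rintro δ δ' ⟨h, C, hC⟩ ⟨h', C', hC'⟩
    exact ⟨h.add h', C + C', fun w => (norm_add_le _ _).trans (add_le_add (hC w) (hC' w))⟩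
  smul_mem' := by
    rintro c δ ⟨h, C, hC⟩
    refine ⟨h.const_smul c, |c| * C, fun w => ?_⟩
    simp only [Pi.smul_apply, norm_smul, Real.norm_eq_abs]
    exact mul_le_mul_of_nonneg_left (hC w) (abs_nonneg c)

variable {p q : ℝ≥0∞} [Fact (1 ≤ p)] [Fact (1 ≤ q)] {ρ : ℝ}
  {ν : Measure (EuclideanSpace ℝ (Fin m))} [IsProbabilityMeasure ν]
  {D : EuclideanSpace ℝ (Fin m) → EuclideanSpace ℝ (Fin m) →L[ℝ] EuclideanSpace ℝ (Fin r)}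

lemma measurable_apply_field (hD : Continuous D)
    {δ : EuclideanSpace ℝ (Fin m) → EuclideanSpace ℝ (Fin m)} (hδ : Measurable δ) :
    Measurable fun w => D w (δ w) :=
  isBoundedBilinearMap_apply.continuous.measurable.comp (hD.measurable.prodMk hδ)

lemma integrable_norm_of_rpow {s : ℝ} (hs : 1 ≤ s) (hD : Continuous D)
    (hDint : Integrable (fun w => ‖D w‖ ^ s) ν) : Integrable (fun w => ‖D w‖) ν := by
  refine Integrable.mono' ((integrable_const 1).add hDint)
    hD.norm.measurable.aestronglyMeasurable (ae_of_all _ fun w => ?_)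
  simp only [Pi.add_apply, norm_norm]
  have h0 : 0 ≤ ‖D w‖ ^ s := by positivity
  rcases le_total ‖D w‖ 1 with h | h
  · linarith
  · have := Real.rpow_le_rpow_of_exponent_le h hs
    rw [Real.rpow_one] at this; linarith

lemma integrable_apply_field (hD : Continuous D) (hDint : Integrable (fun w => ‖D w‖) ν)
    (δ : boundedFields m) : Integrable (fun w => D w (δ.1 w)) ν := by
  obtain ⟨hδ, C, hC⟩ := δ.2
  refine Integrable.mono' (hDint.mul_const C) (measurable_apply_field hD hδ).aestronglyMeasurable
    (ae_of_all _ fun w => ?_)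
  exact ((D w).le_opNorm _).trans (mul_le_mul_of_nonneg_left (hC w) (norm_nonneg _))

variable (ν D) in
/-- The mean first-order effect `∫ D(w) δ(w) dν(w)` of a perturbation field `δ`. -/
noncomputable def meanEffect (hD : Continuous D) (hDint : Integrable (fun w => ‖D w‖) ν) :
    boundedFields m →ₗ[ℝ] EuclideanSpace ℝ (Fin r) where
  toFun δ := ∫ w, D w (δ.1 w) ∂ν
  map_add' δ δ' := by
    rw [← integral_add (integrable_apply_field hD hDint δ) (integrable_apply_field hD hDint δ')]
    simp
  map_smul' c δ := by
    rw [RingHom.id_apply, ← integral_smul]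
    simp

variable (q ρ ν) in
/-- The mean transport cost `∫ ‖δ(w)‖_q ^ ρ dν(w)` of a perturbation field `δ`. -/
noncomputable def meanCost (δ : boundedFields m) : ℝ :=
  ∫ w, vecNorm q (δ.1 w).ofLp ^ ρ ∂ν

lemma meanCost_nonneg (δ : boundedFields m) : 0 ≤ meanCost q ρ ν δ :=
  integral_nonneg fun _ => Real.rpow_nonneg (vecNorm_nonneg q _) _

lemma continuous_vecNorm_ofLp :
    Continuous fun v : EuclideanSpace ℝ (Fin m) => vecNorm q v.ofLp :=
  (continuous_vecNorm q).comp (PiLp.continuous_ofLp 2 _)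

lemma measurable_field_cost (hρ : 1 < ρ)
    {δ : EuclideanSpace ℝ (Fin m) → EuclideanSpace ℝ (Fin m)} (hδ : Measurable δ) :
    Measurable fun w => vecNorm q (δ w).ofLp ^ ρ :=
  ((continuous_vecNorm_ofLp.rpow_const fun _ => Or.inr (by linarith)).measurable).comp hδ

lemma integrable_field_cost (hρ : 1 < ρ) (δ : boundedFields m) :
    Integrable (fun w => vecNorm q (δ.1 w).ofLp ^ ρ) ν := by
  obtain ⟨hδ, C, hC⟩ := δ.2
  obtain ⟨B, hB, h⟩ := exists_vecNorm_le_norm q m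
  refine Integrable.mono' (integrable_const ((B * C) ^ ρ))
    (measurable_field_cost hρ hδ).aestronglyMeasurable (ae_of_all _ fun w => ?_)
  rw [Real.norm_of_nonneg (Real.rpow_nonneg (vecNorm_nonneg q _) _)]
  exact Real.rpow_le_rpow (vecNorm_nonneg q _)
    ((h _).trans (mul_le_mul_of_nonneg_left (hC w) hB.le)) (by linarith)

lemma convexOn_meanCost (hρ : 1 < ρ) :
    ConvexOn ℝ univ (meanCost q ρ ν : boundedFields m → ℝ) := by
  refine ⟨convex_univ, fun δ _ δ' _ a b ha hb hab => ?_⟩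
  simp only [meanCost, smul_eq_mul]
  rw [← integral_const_mul, ← integral_const_mul,
    ← integral_add ((integrable_field_cost hρ δ).const_mul a)
      ((integrable_field_cost hρ δ').const_mul b)]
  refine integral_mono (integrable_field_cost hρ _) (((integrable_field_cost hρ δ).const_mul a).add
      ((integrable_field_cost hρ δ').const_mul b)) fun w => ?_
  have h1 : vecNorm q ((a • δ + b • δ').1 w).ofLp
      ≤ a * vecNorm q (δ.1 w).ofLp + b * vecNorm q (δ'.1 w).ofLp := by
    have h := vecNorm_add_le q (a • (δ.1 w).ofLp) (b • (δ'.1 w).ofLp)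
    rwa [vecNorm_smul, vecNorm_smul, abs_of_nonneg ha, abs_of_nonneg hb] at h
  refine (Real.rpow_le_rpow (vecNorm_nonneg q _) h1 (by linarith)).trans ?_
  exact (convexOn_rpow hρ.le).2 (mem_Ici.2 (vecNorm_nonneg q _)) (mem_Ici.2 (vecNorm_nonneg q _))
    ha hb hab

/-- A functional vanishing on the range is tested against a bounded multiple of the Riesz vector of
`ℓ.comp (D w)`. This forces `ℓ.comp (D w) = 0` almost everywhere, which nondegeneracy excludes for
`ℓ ≠ 0`. -/
lemma surjective_meanEffect (hD : Continuous D) (hDint : Integrable (fun w => ‖D w‖) ν)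
    (hnondeg : ∀ ℓ : EuclideanSpace ℝ (Fin r) →L[ℝ] ℝ, (∀ᵐ w ∂ν, ℓ.comp (D w) = 0) → ℓ = 0) :
    Function.Surjective (meanEffect ν D hD hDint) := by
  rw [← LinearMap.range_eq_top]
  by_contra hne
  obtain ⟨f, hf0, hf⟩ := Submodule.exists_le_ker_of_lt_top _ (lt_top_iff_ne_top.2 hne)
  set ℓ : EuclideanSpace ℝ (Fin r) →L[ℝ] ℝ := LinearMap.toContinuousLinearMap f with hℓ
  have hℓ0 : ℓ ≠ 0 := by
    intro h; apply hf0; ext v; exact congrArg (fun g : _ →L[ℝ] ℝ => g v) h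
  have hcont : Continuous fun w => ℓ.comp (D w) := by fun_prop
  -- The positive factor bounds the field by one although `D` need not be bounded.
  set δ : EuclideanSpace ℝ (Fin m) → EuclideanSpace ℝ (Fin m) := fun w =>
    (1 + ‖ℓ.comp (D w)‖)⁻¹ • (InnerProductSpace.toDual ℝ _).symm (ℓ.comp (D w)) with hδ
  have hpos : ∀ w, 0 < 1 + ‖ℓ.comp (D w)‖ := fun w => by positivity
  have hδm : δ ∈ boundedFields m := by
    refine ⟨Continuous.measurable ?_, 1, fun w => ?_⟩
    · exact ((continuous_const.add hcont.norm).inv₀ fun w => (hpos w).ne').smul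
        ((LinearIsometryEquiv.continuous _).comp hcont)
    · rw [hδ, norm_smul, LinearIsometryEquiv.norm_map, norm_inv,
        Real.norm_of_nonneg (hpos w).le, inv_mul_le_iff₀ (hpos w)]
      linarith
  have hval : ∀ w, ℓ (D w (δ w)) = (1 + ‖ℓ.comp (D w)‖)⁻¹ * ‖ℓ.comp (D w)‖ ^ 2 := by
    intro w
    have h1 : ℓ (D w (δ w)) = (ℓ.comp (D w)) (δ w) := rfl
    rw [h1, hδ, map_smul, smul_eq_mul]
    congr 1
    set φ := ℓ.comp (D w)
    have h2 := InnerProductSpace.toDual_symm_apply (𝕜 := ℝ)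
      (x := (InnerProductSpace.toDual ℝ _).symm φ) (y := φ)
    rw [← h2, real_inner_self_eq_norm_sq, LinearIsometryEquiv.norm_map]
  have hzero : ∫ w, ℓ (D w (δ w)) ∂ν = 0 := by
    rw [ContinuousLinearMap.integral_comp_comm ℓ (integrable_apply_field hD hDint ⟨δ, hδm⟩)]
    exact hf ⟨⟨δ, hδm⟩, rfl⟩
  refine hℓ0 (hnondeg ℓ ?_)
  have hae := (integral_eq_zero_iff_of_nonneg (fun w => by
    rw [hval]; have := hpos w; simp only [Pi.zero_apply]; positivity)
    (ℓ.integrable_comp (integrable_apply_field hD hDint ⟨δ, hδm⟩))).1 hzero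
  filter_upwards [hae] with w hw
  rw [hval, Pi.zero_apply, mul_eq_zero] at hw
  rcases hw with hw | hw
  · exact absurd hw (inv_ne_zero (hpos w).ne')
  · simpa using hw

variable (p ρ ν D) in
/-- The conjugate cost `(ρ - 1) ∫ ‖ℓ D(w)‖_p ^ (ρ / (ρ - 1)) dν(w)` of a linear functional `ℓ`. -/
noncomputable def conjugateCost (ℓ : EuclideanSpace ℝ (Fin r) →L[ℝ] ℝ) : ℝ :=
  (ρ - 1) * ∫ w, dualNorm p (ℓ.comp (D w)) ^ (ρ / (ρ - 1)) ∂ν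

lemma continuous_dualNorm_comp (hD : Continuous D) (ℓ : EuclideanSpace ℝ (Fin r) →L[ℝ] ℝ) :
    Continuous fun w => dualNorm p (ℓ.comp (D w)) :=
  continuous_dualNorm.comp (by fun_prop)

lemma integrable_dualNorm_rpow {s : ℝ} (hs : 0 ≤ s) (hD : Continuous D)
    (hDint : Integrable (fun w => ‖D w‖ ^ s) ν) (ℓ : EuclideanSpace ℝ (Fin r) →L[ℝ] ℝ) :
    Integrable (fun w => dualNorm p (ℓ.comp (D w)) ^ s) ν := by
  obtain ⟨C, hC, h⟩ := exists_dualNorm_le_norm (p := p) (m := m)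
  refine Integrable.mono' (hDint.const_mul ((C * ‖ℓ‖) ^ s))
    ((continuous_dualNorm_comp hD ℓ).rpow_const fun _ => Or.inr hs).measurable.aestronglyMeasurable
    (ae_of_all _ fun w => ?_)
  rw [Real.norm_of_nonneg (Real.rpow_nonneg (dualNorm_nonneg _) _),
    ← Real.mul_rpow (by positivity) (norm_nonneg _)]
  refine Real.rpow_le_rpow (dualNorm_nonneg _) ((h _).trans ?_) hs
  rw [mul_assoc]
  exact mul_le_mul_of_nonneg_left (ContinuousLinearMap.opNorm_comp_le _ _) hC.le

/-- Hölder followed by Young. Together with `fenchel_attained` it computes the convex conjugate of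
the transport cost. -/
lemma fenchel_le (hρ : 1 < ρ) (hpq : p⁻¹ + q⁻¹ = 1)
    (φ : EuclideanSpace ℝ (Fin m) →L[ℝ] ℝ) (v : EuclideanSpace ℝ (Fin m)) :
    ρ * φ v - vecNorm q v.ofLp ^ ρ ≤ (ρ - 1) * dualNorm p φ ^ (ρ / (ρ - 1)) := by
  have h1 := young_le hρ (dualNorm_nonneg (p := p) φ) (vecNorm_nonneg q v.ofLp)
  have h2 := mul_le_mul_of_nonneg_left (le_dualNorm_mul hpq φ v) (by linarith : 0 ≤ ρ)
  linarith

/-- Equality in both inequalities is reached by a Hölder-extremal direction scaled by `‖φ‖_p ^ (1 /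
(ρ - 1))`. -/
lemma fenchel_attained (hρ : 1 < ρ) (hpq : p⁻¹ + q⁻¹ = 1)
    (φ : EuclideanSpace ℝ (Fin m) →L[ℝ] ℝ) :
    ∃ v : EuclideanSpace ℝ (Fin m),
      (ρ - 1) * dualNorm p φ ^ (ρ / (ρ - 1)) ≤ ρ * φ v - vecNorm q v.ofLp ^ ρ := by
  obtain ⟨v, hv, hφ⟩ := exists_eq_dualNorm hpq φ
  set s := dualNorm p φ ^ (1 / (ρ - 1)) with hs
  have hs0 : 0 ≤ s := Real.rpow_nonneg (dualNorm_nonneg _) _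
  refine ⟨s • v, ?_⟩
  have h1 := young_eq hρ (dualNorm_nonneg (p := p) φ)
  have h2 : vecNorm q (s • v).ofLp ^ ρ ≤ s ^ ρ := by
    refine Real.rpow_le_rpow (vecNorm_nonneg q _) ?_ (by linarith)
    rw [WithLp.ofLp_smul, vecNorm_smul, abs_of_nonneg hs0]
    exact mul_le_of_le_one_right hs0 hv
  rw [map_smul, hφ, smul_eq_mul, mul_comm s]
  rw [← hs] at h1
  linarith

lemma weak_duality (hρ : 1 < ρ) (hpq : p⁻¹ + q⁻¹ = 1) (hD : Continuous D)
    (hDint : Integrable (fun w => ‖D w‖) ν)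
    (hDint' : Integrable (fun w => ‖D w‖ ^ (ρ / (ρ - 1))) ν)
    (ℓ : EuclideanSpace ℝ (Fin r) →L[ℝ] ℝ) (δ : boundedFields m) :
    ρ * ℓ (meanEffect ν D hD hDint δ) - conjugateCost p ρ ν D ℓ ≤ meanCost q ρ ν δ := by
  have hs : 0 ≤ ρ / (ρ - 1) := by have := one_lt_dualExponent hρ; linarith
  have hi := ℓ.integrable_comp (integrable_apply_field hD hDint δ)
  have e : ρ * ℓ (meanEffect ν D hD hDint δ) = ∫ w, ρ * ℓ (D w (δ.1 w)) ∂ν := by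
    rw [integral_const_mul, ContinuousLinearMap.integral_comp_comm ℓ
      (integrable_apply_field hD hDint δ)]
    rfl
  rw [e, sub_le_iff_le_add, meanCost, conjugateCost, ← integral_const_mul,
    ← integral_add (integrable_field_cost hρ δ)
      ((integrable_dualNorm_rpow hs hD hDint' ℓ).const_mul _)]
  refine integral_mono (hi.const_mul ρ) ((integrable_field_cost hρ δ).add
    ((integrable_dualNorm_rpow hs hD hDint' ℓ).const_mul _)) fun w => ?_
  have := fenchel_le hρ hpq (ℓ.comp (D w)) (δ.1 w)
  simp only [ContinuousLinearMap.comp_apply] at this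
  linarith

/-- Successive improvements of a perturbation field along a sequence of candidate directions. -/
noncomputable def greedyField (obj : EuclideanSpace ℝ (Fin m) → EuclideanSpace ℝ (Fin m) → ℝ)
    (d : ℕ → EuclideanSpace ℝ (Fin m)) : ℕ → EuclideanSpace ℝ (Fin m) → EuclideanSpace ℝ (Fin m)
  | 0 => 0
  | n + 1 => fun w => if obj w (greedyField obj d n w) < obj w (d n) then d n
      else greedyField obj d n w

section Greedy

variable {obj : EuclideanSpace ℝ (Fin m) → EuclideanSpace ℝ (Fin m) → ℝ}
  {d : ℕ → EuclideanSpace ℝ (Fin m)}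

/-- Each stage takes finitely many values, so it is bounded; a field of exact maximisers need not
be. -/
lemma greedyField_mem (hobj : Measurable (Function.uncurry obj)) (n : ℕ) :
    greedyField obj d n ∈ boundedFields m := by
  induction n with
  | zero => exact zero_mem _
  | succ n ih =>
    obtain ⟨h, C, hC⟩ := ih
    refine ⟨Measurable.ite (measurableSet_lt (hobj.comp (measurable_id.prodMk h))
      (hobj.comp (measurable_id.prodMk measurable_const))) measurable_const h,
      max C ‖d n‖, fun w => ?_⟩
    simp only [greedyField]
    split_ifs
    · exact le_max_right _ _
    · exact (hC w).trans (le_max_left _ _)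

lemma le_obj_greedyField_succ (n : ℕ) (w : EuclideanSpace ℝ (Fin m)) :
    obj w (greedyField obj d n w) ≤ obj w (greedyField obj d (n + 1) w) := by
  simp only [greedyField]
  split_ifs with h
  · exact h.le
  · exact le_rfl

lemma monotone_obj_greedyField (w : EuclideanSpace ℝ (Fin m)) :
    Monotone fun n => obj w (greedyField obj d n w) :=
  monotone_nat_of_le_succ fun n => le_obj_greedyField_succ n w

lemma obj_le_greedyField {k n : ℕ} (h : k < n) (w : EuclideanSpace ℝ (Fin m)) :
    obj w (d k) ≤ obj w (greedyField obj d n w) := by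
  refine le_trans ?_ (monotone_obj_greedyField w (Nat.succ_le_of_lt h))
  simp only [greedyField]
  split_ifs with h
  · exact le_rfl
  · exact not_lt.1 h

end Greedy

/-- Interchange of supremum and integral in the conjugate cost. -/
lemma conjugateCost_le (hρ : 1 < ρ) (hpq : p⁻¹ + q⁻¹ = 1) (hD : Continuous D)
    (hDint : Integrable (fun w => ‖D w‖) ν)
    (hDint' : Integrable (fun w => ‖D w‖ ^ (ρ / (ρ - 1))) ν)
    (ℓ : EuclideanSpace ℝ (Fin r) →L[ℝ] ℝ) {K : ℝ}
    (hK : ∀ δ : boundedFields m,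
      ρ * ℓ (meanEffect ν D hD hDint δ) - meanCost q ρ ν δ ≤ K) :
    conjugateCost p ρ ν D ℓ ≤ K := by
  have hs : 0 ≤ ρ / (ρ - 1) := by have := one_lt_dualExponent hρ; linarith
  set obj : EuclideanSpace ℝ (Fin m) → EuclideanSpace ℝ (Fin m) → ℝ :=
    fun w v => ρ * ℓ (D w v) - vecNorm q v.ofLp ^ ρ with hobj
  have hobjc : Continuous (Function.uncurry obj) := by
    have h1 : Continuous fun x : EuclideanSpace ℝ (Fin m) × EuclideanSpace ℝ (Fin m) =>
        D x.1 x.2 := (hD.comp continuous_fst).clm_apply continuous_snd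
    have h2 : Continuous fun x : EuclideanSpace ℝ (Fin m) × EuclideanSpace ℝ (Fin m) =>
        vecNorm q x.2.ofLp ^ ρ := (continuous_vecNorm_ofLp.rpow_const fun _ =>
          Or.inr (by linarith)).comp continuous_snd
    exact (continuous_const.mul (ℓ.continuous.comp h1)).sub h2
  set d := TopologicalSpace.denseSeq (EuclideanSpace ℝ (Fin m)) with hd
  set G : ℕ → EuclideanSpace ℝ (Fin m) → EuclideanSpace ℝ (Fin m) := greedyField obj d with hG
  have hGm : ∀ n, G n ∈ boundedFields m := fun n => greedyField_mem hobjc.measurable n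
  have hobj_le : ∀ w v, obj w v ≤ (ρ - 1) * dualNorm p (ℓ.comp (D w)) ^ (ρ / (ρ - 1)) :=
    fun w v => fenchel_le hρ hpq (ℓ.comp (D w)) v
  -- The greedy scheme starts from the zero field, where the objective vanishes, and only improves.
  -- This is the lower half of the domination used below.
  have hobj0 : ∀ n w, 0 ≤ obj w (G n w) := by
    intro n w
    refine le_trans (le_of_eq ?_) (monotone_obj_greedyField (obj := obj) (d := d) w n.zero_le)
    simp [hobj, greedyField, vecNorm_zero, Real.zero_rpow (by linarith : ρ ≠ 0)]
  have hint : ∀ n, ∫ w, obj w (G n w) ∂ν ≤ K := by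
    intro n
    refine le_trans (le_of_eq ?_) (hK ⟨G n, hGm n⟩)
    have hi := integrable_apply_field hD hDint ⟨G n, hGm n⟩
    simp only [hobj]
    rw [integral_sub ((ℓ.integrable_comp hi).const_mul ρ)
      (integrable_field_cost hρ ⟨G n, hGm n⟩), integral_const_mul,
      ContinuousLinearMap.integral_comp_comm ℓ hi]
    rfl
  have hlim : Tendsto (fun n => ∫ w, obj w (G n w) ∂ν) atTop (𝓝 (conjugateCost p ρ ν D ℓ)) := by
    rw [conjugateCost, ← integral_const_mul]
    refine tendsto_integral_of_dominated_convergence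
      (fun w => (ρ - 1) * dualNorm p (ℓ.comp (D w)) ^ (ρ / (ρ - 1)))
      (fun n => (hobjc.measurable.comp (measurable_id.prodMk (hGm n).1)).aestronglyMeasurable)
      ((integrable_dualNorm_rpow hs hD hDint' ℓ).const_mul _)
      (fun n => ae_of_all _ fun w => ?_) (ae_of_all _ fun w => ?_)
    · rw [Real.norm_of_nonneg (hobj0 n w)]; exact hobj_le w _
    -- The maximiser need not be a candidate direction, but by continuity some point of the dense
    -- sequence does almost as well.
    · obtain ⟨v, hv⟩ := fenchel_attained hρ hpq (ℓ.comp (D w))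
      refine tendsto_order.2 ⟨fun a ha => ?_, fun a ha => Eventually.of_forall fun n =>
        (hobj_le w _).trans_lt ha⟩
      have hopen : IsOpen {u | a < obj w u} :=
        isOpen_lt continuous_const (hobjc.comp (Continuous.prodMk_right w))
      obtain ⟨k, hk⟩ := (TopologicalSpace.denseRange_denseSeq
        (EuclideanSpace ℝ (Fin m))).exists_mem_open hopen ⟨v, ha.trans_le hv⟩
      filter_upwards [eventually_gt_atTop k] with n hn
      exact lt_of_lt_of_le hk (obj_le_greedyField hn w)
  exact le_of_tendsto' hlim hint

/-- Strong duality for the population problem, with attainment on the dual side. -/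
lemma strong_duality (hρ : 1 < ρ) (hpq : p⁻¹ + q⁻¹ = 1) (hD : Continuous D)
    (hDint : Integrable (fun w => ‖D w‖) ν)
    (hDint' : Integrable (fun w => ‖D w‖ ^ (ρ / (ρ - 1))) ν)
    (hnondeg : ∀ ℓ : EuclideanSpace ℝ (Fin r) →L[ℝ] ℝ, (∀ᵐ w ∂ν, ℓ.comp (D w) = 0) → ℓ = 0)
    (x : EuclideanSpace ℝ (Fin r)) :
    IsGreatest (range fun ℓ : EuclideanSpace ℝ (Fin r) →L[ℝ] ℝ =>
        ρ * ℓ x - conjugateCost p ρ ν D ℓ)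
      (valueFunction (meanEffect ν D hD hDint) (meanCost q ρ ν) x) := by
  have hT := surjective_meanEffect hD hDint hnondeg
  have hub : ∀ ℓ : EuclideanSpace ℝ (Fin r) →L[ℝ] ℝ, ρ * ℓ x - conjugateCost p ρ ν D ℓ
      ≤ valueFunction (meanEffect ν D hD hDint) (meanCost q ρ ν) x := by
    intro ℓ
    refine le_valueFunction hT fun δ hδ => ?_
    rw [← hδ]
    exact weak_duality hρ hpq hD hDint hDint' ℓ δ
  refine ⟨?_, by rintro _ ⟨ℓ, rfl⟩; exact hub ℓ⟩
  obtain ⟨ℓ, hℓ⟩ := exists_dual_certificate hT (meanCost_nonneg (q := q) (ν := ν))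
    (convexOn_meanCost hρ) x
  have hρ0 : ρ ≠ 0 := by linarith
  -- The dual objective carries the factor `ρ` in its linear term, so the multiplier is divided by
  -- `ρ`.
  refine ⟨ρ⁻¹ • ℓ, le_antisymm (hub _) ?_⟩
  have h1 := conjugateCost_le (q := q) hρ hpq hD hDint hDint' (ρ⁻¹ • ℓ)
    (K := ℓ x - valueFunction (meanEffect ν D hD hDint) (meanCost q ρ ν) x) (fun δ => by
      have := hℓ δ
      rw [map_sub] at this
      simp only [smul_apply, smul_eq_mul, mul_inv_cancel_left₀ hρ0]
      linarith)
  simp only [smul_apply, smul_eq_mul, mul_inv_cancel_left₀ hρ0]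
  linarith

end PopulationDuality

/-! ### The profile function at finite sample size. -/

section Profile

variable {m l r : ℕ} {q : ℝ≥0∞} [Fact (1 ≤ q)] {ρ : ℝ}

lemma cost_nonneg (u w : EuclideanSpace ℝ (Fin m)) : 0 ≤ cost q ρ u w :=
  Real.rpow_nonneg (vecNorm_nonneg q _) _

lemma continuous_cost (hρ : 1 < ρ) :
    Continuous fun z : EuclideanSpace ℝ (Fin m) × EuclideanSpace ℝ (Fin m) =>
      cost q ρ z.1 z.2 :=
  (continuous_vecNorm_ofLp.comp (continuous_fst.sub continuous_snd)).rpow_const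
    fun _ => Or.inr (by linarith)

lemma continuous_cost_left (hρ : 1 < ρ) (y : EuclideanSpace ℝ (Fin m)) :
    Continuous fun u => cost q ρ u y :=
  (continuous_vecNorm_ofLp.comp (continuous_id.sub continuous_const)).rpow_const
    fun _ => Or.inr (by linarith)

lemma continuous_cost_right (hρ : 1 < ρ) (u : EuclideanSpace ℝ (Fin m)) :
    Continuous fun y => cost q ρ u y :=
  (continuous_vecNorm_ofLp.comp (continuous_const.sub continuous_id)).rpow_const
    fun _ => Or.inr (by linarith)

lemma rpow_add_le_two_mul {a b s : ℝ} (ha : 0 ≤ a) (hb : 0 ≤ b) (hs : 0 ≤ s) :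
    (a + b) ^ s ≤ 2 ^ s * (a ^ s + b ^ s) := by
  have ha' := Real.rpow_nonneg ha s
  have hb' := Real.rpow_nonneg hb s
  have h2 : (0 : ℝ) ≤ 2 ^ s := by positivity
  rcases le_total a b with h | h
  · calc (a + b) ^ s ≤ (2 * b) ^ s := Real.rpow_le_rpow (by positivity) (by linarith) hs
      _ = 2 ^ s * b ^ s := Real.mul_rpow (by norm_num) hb
      _ ≤ _ := mul_le_mul_of_nonneg_left (by linarith) h2
  · calc (a + b) ^ s ≤ (2 * a) ^ s := Real.rpow_le_rpow (by positivity) (by linarith) hs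
      _ = 2 ^ s * a ^ s := Real.mul_rpow (by norm_num) ha
      _ ≤ _ := mul_le_mul_of_nonneg_left (by linarith) h2

lemma cost_le_two_mul (hρ : 1 < ρ) (u v w : EuclideanSpace ℝ (Fin m)) :
    cost q ρ u w ≤ 2 ^ ρ * (cost q ρ u v + cost q ρ v w) := by
  refine le_trans (Real.rpow_le_rpow (vecNorm_nonneg q _) ?_ (by linarith))
    (rpow_add_le_two_mul (vecNorm_nonneg q (u - v).ofLp) (vecNorm_nonneg q (v - w).ofLp)
      (by linarith))
  have := vecNorm_add_le q (u - v).ofLp (v - w).ofLp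
  rwa [← WithLp.ofLp_add, sub_add_sub_cancel] at this

/-- A family of conditional laws transporting the empirical distribution to a distribution that
solves the estimating equation. -/
structure IsFeasible (g : EuclideanSpace ℝ (Fin m) → EuclideanSpace ℝ (Fin r)) (n : ℕ)
    (K : ℕ → Measure (EuclideanSpace ℝ (Fin m))) : Prop where
  prob : ∀ i, IsProbabilityMeasure (K i)
  integrable : ∀ i ∈ Finset.range n, Integrable g (K i)
  sum_eq_zero : ∑ i ∈ Finset.range n, ∫ u, g u ∂(K i) = 0

variable (q ρ) in
/-- The transport cost of a family of conditional laws. -/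
noncomputable def kernelCost (n : ℕ) (x : ℕ → EuclideanSpace ℝ (Fin m))
    (K : ℕ → Measure (EuclideanSpace ℝ (Fin m))) : ℝ≥0∞ :=
  (n : ℝ≥0∞)⁻¹ * ∑ i ∈ Finset.range n, ∫⁻ u, ENNReal.ofReal (cost q ρ u (x i)) ∂(K i)

variable {h : EuclideanSpace ℝ (Fin m) → EuclideanSpace ℝ (Fin l) → EuclideanSpace ℝ (Fin r)}
  {θ : EuclideanSpace ℝ (Fin l)} {n : ℕ} {x : ℕ → EuclideanSpace ℝ (Fin m)}

/-- The average of the conditional laws solves the estimating equation, and gluing `K i` to the atom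
`x i` couples it with the empirical distribution. -/
lemma profile_le_kernelCost (hρ : 1 < ρ) (hn : 1 ≤ n)
    {K : ℕ → Measure (EuclideanSpace ℝ (Fin m))} (hK : IsFeasible (fun w => h w θ) n K) :
    profile q ρ h n x θ ≤ kernelCost q ρ n x K := by
  have := hK.prob
  have hn0 : (n : ℝ≥0∞) ≠ 0 := by exact_mod_cast (by omega : n ≠ 0)
  set P : Measure (EuclideanSpace ℝ (Fin m)) := (n : ℝ≥0∞)⁻¹ • ∑ i ∈ Finset.range n, K i with hP
  have hPprob : IsProbabilityMeasure P := by
    refine ⟨?_⟩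
    simp [hP, Measure.finsetSum_apply, ENNReal.inv_mul_cancel hn0]
  have hPint : Integrable (fun w => h w θ) P :=
    (integrable_finsetSum_measure.2 hK.integrable).smul_measure (by simpa using hn0)
  have hPzero : ∫ w, h w θ ∂P = 0 := by
    rw [hP, integral_smul_measure, integral_finsetSum_measure hK.integrable, hK.sum_eq_zero,
      smul_zero]
  refine iInf_le_of_le P (iInf_le_of_le hPprob (iInf_le_of_le hPint (iInf_le_of_le hPzero ?_)))
  have hc : Measurable fun z : EuclideanSpace ℝ (Fin m) × EuclideanSpace ℝ (Fin m) =>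
      ENNReal.ofReal (cost q ρ z.1 z.2) := (continuous_cost hρ).measurable.ennreal_ofReal
  set π : Measure (EuclideanSpace ℝ (Fin m) × EuclideanSpace ℝ (Fin m)) :=
    (n : ℝ≥0∞)⁻¹ • ∑ i ∈ Finset.range n, (K i).prod (Measure.dirac (x i)) with hπ
  have h1 : π.map Prod.fst = P := by
    rw [hπ, Measure.map_smul, Measure.map_finset_sum measurable_fst.aemeasurable, hP]
    simp [Measure.map_fst_prod]
  have h2 : π.map Prod.snd = empirical n x := by
    rw [hπ, Measure.map_smul, Measure.map_finset_sum measurable_snd.aemeasurable, empirical]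
    simp [Measure.map_snd_prod]
  refine iInf_le_of_le π (iInf_le_of_le h1 (iInf_le_of_le h2 (le_of_eq ?_)))
  rw [hπ, lintegral_smul_measure, lintegral_finsetSum_measure, kernelCost, smul_eq_mul]
  congr 1
  refine Finset.sum_congr rfl fun i _ => ?_
  rw [Measure.prod_dirac, lintegral_map hc (by fun_prop)]

/-- After a swap the empirical law is the first marginal, and disintegration gives a conditional law
at each sample point. The marginal is a finite sum of atoms, so all integrals become finite
averages; tied sample points merely share a law. -/
lemma exists_kernelCost_eq (hρ : 1 < ρ) (hn : 1 ≤ n)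
    {P : Measure (EuclideanSpace ℝ (Fin m))} [IsProbabilityMeasure P]
    (hPint : Integrable (fun w => h w θ) P) (hPzero : ∫ w, h w θ ∂P = 0)
    {π : Measure (EuclideanSpace ℝ (Fin m) × EuclideanSpace ℝ (Fin m))}
    (h1 : π.map Prod.fst = P) (h2 : π.map Prod.snd = empirical n x) :
    ∃ K, IsFeasible (fun w => h w θ) n K ∧
      ∫⁻ z, ENNReal.ofReal (cost q ρ z.1 z.2) ∂π = kernelCost q ρ n x K := by
  have hn0 : (n : ℝ≥0∞) ≠ 0 := by exact_mod_cast (by omega : n ≠ 0)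
  have hc : Measurable fun z : EuclideanSpace ℝ (Fin m) × EuclideanSpace ℝ (Fin m) =>
      ENNReal.ofReal (cost q ρ z.1 z.2) := (continuous_cost hρ).measurable.ennreal_ofReal
  have hπprob : IsProbabilityMeasure π := by
    refine ⟨?_⟩
    have := measure_univ (μ := P)
    rwa [← h1, Measure.map_apply measurable_fst MeasurableSet.univ, preimage_univ] at this
  set π' := π.map Prod.swap with hπ'
  have : IsProbabilityMeasure π' := Measure.isProbabilityMeasure_map measurable_swap.aemeasurable
  have hfst : π'.fst = empirical n x := by
    rw [Measure.fst, hπ', Measure.map_map measurable_fst measurable_swap, ← h2]; rfl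
  have hsnd : π'.snd = P := by
    rw [Measure.snd, hπ', Measure.map_map measurable_snd measurable_swap, ← h1]; rfl
  set K : ℕ → Measure (EuclideanSpace ℝ (Fin m)) := fun i => π'.condKernel (x i) with hK
  have hdis : ∀ f : EuclideanSpace ℝ (Fin m) × EuclideanSpace ℝ (Fin m) → ℝ≥0∞, Measurable f →
      ∫⁻ z, f z ∂π' = (n : ℝ≥0∞)⁻¹ * ∑ i ∈ Finset.range n, ∫⁻ u, f (x i, u) ∂(K i) := by
    intro f hf
    rw [← π'.disintegrate π'.condKernel, Measure.lintegral_compProd hf, hfst, empirical,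
      lintegral_smul_measure, lintegral_finsetSum_measure, smul_eq_mul]
    congr 1
    refine Finset.sum_congr rfl fun i _ => ?_
    rw [lintegral_dirac, hK]
  have hPK : P = (n : ℝ≥0∞)⁻¹ • ∑ i ∈ Finset.range n, K i := by
    ext s hs
    rw [← hsnd, Measure.snd_apply hs, ← lintegral_indicator_one (measurable_snd hs),
      hdis _ (measurable_one.indicator (measurable_snd hs))]
    simp only [Measure.smul_apply, Measure.finsetSum_apply, smul_eq_mul]
    congr 1
    refine Finset.sum_congr rfl fun i _ => ?_
    rw [← lintegral_indicator_one hs]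
    rfl
  have hint : ∀ i ∈ Finset.range n, Integrable (fun w => h w θ) (K i) := by
    rw [hPK, integrable_smul_measure (by simp) (by simpa using hn0)] at hPint
    exact integrable_finsetSum_measure.1 hPint
  refine ⟨K, ⟨fun i => by rw [hK]; infer_instance, hint, ?_⟩, ?_⟩
  · rw [hPK, integral_smul_measure, integral_finsetSum_measure hint] at hPzero
    refine (smul_eq_zero.1 hPzero).resolve_left ?_
    rw [ENNReal.toReal_inv, ENNReal.toReal_natCast]
    exact inv_ne_zero (by exact_mod_cast (by omega : n ≠ 0))
  · have hc' : Measurable fun z : EuclideanSpace ℝ (Fin m) × EuclideanSpace ℝ (Fin m) =>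
        ENNReal.ofReal (cost q ρ z.2 z.1) := by
      have := hc.comp (measurable_swap (α := EuclideanSpace ℝ (Fin m)) (β := EuclideanSpace ℝ (Fin m)))
      exact this
    have e : ∫⁻ z, ENNReal.ofReal (cost q ρ z.1 z.2) ∂π
        = ∫⁻ z, ENNReal.ofReal (cost q ρ z.2 z.1) ∂π' := by
      rw [hπ', lintegral_map hc' measurable_swap]
      simp only [Prod.snd_swap, Prod.fst_swap]
    rw [e, hdis _ hc', kernelCost]

/-- In this form the class of competitors does not depend on the sample, which enters only through
the cost. Both measurability and weak duality rest on this. -/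
lemma profile_eq_iInf (hρ : 1 < ρ) (hn : 1 ≤ n) :
    profile q ρ h n x θ
      = ⨅ (K : ℕ → Measure (EuclideanSpace ℝ (Fin m))) (_ : IsFeasible (fun w => h w θ) n K),
        kernelCost q ρ n x K := by
  refine le_antisymm (le_iInf₂ fun K hK => profile_le_kernelCost hρ hn hK) ?_
  refine le_iInf fun P => le_iInf fun _ => le_iInf fun hPi => le_iInf fun hP0 => ?_
  refine le_iInf fun π => le_iInf fun h1 => le_iInf fun h2 => ?_
  obtain ⟨K, hK, hcost⟩ := exists_kernelCost_eq (q := q) hρ hn hPi hP0 h1 h2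
  rw [hcost]
  exact iInf₂_le K hK

lemma lintegral_cost_ne_top (hρ : 1 < ρ) {K : Measure (EuclideanSpace ℝ (Fin m))}
    [IsProbabilityMeasure K] {y : EuclideanSpace ℝ (Fin m)}
    (hy : ∫⁻ u, ENNReal.ofReal (cost q ρ u y) ∂K ≠ ∞) {C : ℝ} :
    ∫⁻ u, ENNReal.ofReal (2 ^ ρ * (cost q ρ u y + C)) ∂K ≠ ∞ := by
  have hm : Measurable fun u => cost q ρ u y :=
    (continuous_cost_left hρ y).measurable
  have hi : Integrable (fun u => cost q ρ u y) K := by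
    refine ⟨hm.aestronglyMeasurable, ?_⟩
    rw [hasFiniteIntegral_iff_ofReal (ae_of_all _ fun u => cost_nonneg u y)]
    exact hy.lt_top
  exact ((hi.add (integrable_const C)).const_mul (2 ^ ρ)).lintegral_lt_top.ne

/-- Dominated convergence: near `y` the cost from `u` is at most a constant times one plus its cost
to `y`. -/
lemma continuousAt_lintegral_cost (hρ : 1 < ρ) {K : Measure (EuclideanSpace ℝ (Fin m))}
    [IsProbabilityMeasure K] {y : EuclideanSpace ℝ (Fin m)}
    (hy : ∫⁻ u, ENNReal.ofReal (cost q ρ u y) ∂K ≠ ∞) :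
    ContinuousAt (fun z => ∫⁻ u, ENNReal.ofReal (cost q ρ u z) ∂K) y := by
  have hcont : Continuous fun z => cost q ρ y z :=
    continuous_cost_right hρ y
  have h0 : cost q ρ y y < 1 := by
    simp [cost, vecNorm_zero, Real.zero_rpow (by linarith : ρ ≠ 0)]
  refine tendsto_lintegral_filter_of_dominated_convergence
    (fun u => ENNReal.ofReal (2 ^ ρ * (cost q ρ u y + 1))) (Eventually.of_forall fun z => ?_) ?_
    (lintegral_cost_ne_top hρ hy) (ae_of_all _ fun u => ?_)
  · exact (continuous_cost_left hρ z).measurable.ennreal_ofReal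
  · filter_upwards [hcont.continuousAt.eventually (gt_mem_nhds h0)] with z hz
    refine ae_of_all _ fun u => ENNReal.ofReal_le_ofReal ((cost_le_two_mul hρ u y z).trans ?_)
    have : (0 : ℝ) ≤ 2 ^ ρ := by positivity
    exact mul_le_mul_of_nonneg_left (by linarith) this
  · exact ENNReal.tendsto_ofReal
      (continuous_cost_right hρ u).continuousAt

lemma upperSemicontinuous_kernelCost (hρ : 1 < ρ) (hn : 1 ≤ n)
    {K : ℕ → Measure (EuclideanSpace ℝ (Fin m))} (hK : ∀ i, IsProbabilityMeasure (K i)) :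
    UpperSemicontinuous fun x => kernelCost q ρ n x K := by
  intro x
  have hn0 : (n : ℝ≥0∞) ≠ 0 := by exact_mod_cast (by omega : n ≠ 0)
  by_cases hx : ∀ i ∈ Finset.range n, ∫⁻ u, ENNReal.ofReal (cost q ρ u (x i)) ∂(K i) ≠ ∞
  · refine ContinuousAt.upperSemicontinuousAt ?_
    refine ENNReal.Tendsto.const_mul (tendsto_finsetSum _ fun i hi => ?_)
      (Or.inr (by simpa using hn0))
    exact ContinuousAt.comp (f := fun x : ℕ → EuclideanSpace ℝ (Fin m) => x i)
      (continuousAt_lintegral_cost hρ (hx i hi)) (continuous_apply i).continuousAt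
  · push Not at hx
    obtain ⟨i, hi, htop⟩ := hx
    have : kernelCost q ρ n x K = ∞ := by
      rw [kernelCost, ENNReal.sum_eq_top.2 ⟨i, hi, htop⟩]
      exact ENNReal.mul_top (by simp)
    intro c hc
    simp only [this] at hc
    exact absurd hc not_top_lt

/-- The infimum is over an uncountable family, which preserves upper semicontinuity but not
measurability in general. -/
lemma measurable_profile (hρ : 1 < ρ) (hn : 1 ≤ n) :
    Measurable fun x : ℕ → EuclideanSpace ℝ (Fin m) => profile q ρ h n x θ := by
  refine UpperSemicontinuous.measurable ?_
  simp only [profile_eq_iInf hρ hn]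
  exact upperSemicontinuous_iInf fun K => upperSemicontinuous_iInf fun hK =>
    upperSemicontinuous_kernelCost hρ hn hK.prob

/-- The law `ν` itself satisfies the constraint, and its independent coupling with the sample has
finite cost by the moment condition. -/
lemma profile_ne_top (hρ : 1 < ρ) (hn : 1 ≤ n) {ν : Measure (EuclideanSpace ℝ (Fin m))}
    [IsProbabilityMeasure ν] (hint : Integrable (fun w => h w θ) ν) (h0 : ∫ w, h w θ ∂ν = 0)
    (hmom : Integrable (fun w => vecNorm q w.ofLp ^ ρ) ν) : profile q ρ h n x θ ≠ ∞ := by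
  have hn0 : (n : ℝ≥0∞) ≠ 0 := by exact_mod_cast (by omega : n ≠ 0)
  have hfeas : IsFeasible (fun w => h w θ) n fun _ => ν :=
    ⟨fun _ => inferInstance, fun _ _ => hint, by simp [h0]⟩
  refine ne_top_of_le_ne_top ?_ (profile_le_kernelCost hρ hn hfeas)
  refine ENNReal.mul_ne_top (by simpa using hn0) (ENNReal.sum_ne_top.2 fun i _ => ?_)
  have h1 : ∫⁻ u, ENNReal.ofReal (cost q ρ u 0) ∂ν ≠ ∞ := by
    simp only [cost, sub_zero]
    exact hmom.lintegral_lt_top.ne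
  refine ne_top_of_le_ne_top (lintegral_cost_ne_top hρ h1 (C := cost q ρ 0 (x i))) ?_
  exact lintegral_mono fun u => ENNReal.ofReal_le_ofReal (cost_le_two_mul hρ u 0 (x i))

/-- Perturbing each observation to a random one of finitely many positions bounds the profile
function from above. -/
lemma profile_le_of_convexCombination (hρ : 1 < ρ) (hn : 1 ≤ n) {ι : Type*} [Fintype ι]
    {α : ι → ℝ} (hα : ∀ k, 0 ≤ α k) (hα1 : ∑ k, α k = 1) {u : ι → ℕ → EuclideanSpace ℝ (Fin m)}
    (h0 : ∑ k, α k • ∑ i ∈ Finset.range n, h (u k i) θ = 0) :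
    profile q ρ h n x θ
      ≤ ENNReal.ofReal (∑ k, α k * ((n : ℝ)⁻¹ * ∑ i ∈ Finset.range n, cost q ρ (u k i) (x i))) := by
  have hn0 : (n : ℝ≥0∞) ≠ 0 := by exact_mod_cast (by omega : n ≠ 0)
  set K : ℕ → Measure (EuclideanSpace ℝ (Fin m)) :=
    fun i => ∑ k, ENNReal.ofReal (α k) • Measure.dirac (u k i) with hK
  have hi : ∀ i, ∀ k ∈ Finset.univ, Integrable (fun w => h w θ)
      (ENNReal.ofReal (α k) • Measure.dirac (u k i)) := fun i k _ =>
    (integrable_dirac (by simp)).smul_measure (by simp)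
  have hfeas : IsFeasible (fun w => h w θ) n K := by
    refine ⟨fun i => ⟨?_⟩, fun i _ => integrable_finsetSum_measure.2 (hi i), ?_⟩
    · simp only [hK, Measure.finsetSum_apply, Measure.smul_apply, measure_univ, smul_eq_mul, mul_one]
      rw [← ENNReal.ofReal_sum_of_nonneg fun k _ => hα k, hα1, ENNReal.ofReal_one]
    · rw [← h0]
      simp only [hK, Finset.smul_sum]
      rw [Finset.sum_comm]
      refine Finset.sum_congr rfl fun i _ => ?_
      rw [integral_finsetSum_measure (hi i)]
      refine Finset.sum_congr rfl fun k _ => ?_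
      rw [integral_smul_measure, integral_dirac, ENNReal.toReal_ofReal (hα k)]
  refine (profile_le_kernelCost hρ hn hfeas).trans (le_of_eq ?_)
  have e : ∑ k, α k * ((n : ℝ)⁻¹ * ∑ i ∈ Finset.range n, cost q ρ (u k i) (x i))
      = (n : ℝ)⁻¹ * ∑ i ∈ Finset.range n, ∑ k, α k * cost q ρ (u k i) (x i) := by
    simp only [Finset.mul_sum]
    rw [Finset.sum_comm]
    exact Finset.sum_congr rfl fun i _ => Finset.sum_congr rfl fun k _ => by ring
  have hn' : (0 : ℝ) < n := by exact_mod_cast hn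
  rw [e, ENNReal.ofReal_mul (by positivity), ENNReal.ofReal_inv_of_pos hn', ENNReal.ofReal_natCast,
    kernelCost, ENNReal.ofReal_sum_of_nonneg fun i _ =>
      Finset.sum_nonneg fun k _ => mul_nonneg (hα k) (cost_nonneg _ _)]
  congr 1
  refine Finset.sum_congr rfl fun i _ => ?_
  rw [hK, lintegral_finsetSum_measure, ENNReal.ofReal_sum_of_nonneg fun k _ =>
    mul_nonneg (hα k) (cost_nonneg _ _)]
  refine Finset.sum_congr rfl fun k _ => ?_
  rw [lintegral_smul_measure, lintegral_dirac, smul_eq_mul, ENNReal.ofReal_mul (hα k)]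

/-- Weak duality for the profile function. -/
lemma le_profile_of_forall_le (hρ : 1 < ρ) (hn : 1 ≤ n)
    (ℓ : EuclideanSpace ℝ (Fin r) →L[ℝ] ℝ) {f : ℕ → ℝ}
    (hf : ∀ i ∈ Finset.range n, ∀ u, f i ≤ cost q ρ u (x i) + ℓ (h u θ)) :
    ENNReal.ofReal ((n : ℝ)⁻¹ * ∑ i ∈ Finset.range n, f i) ≤ profile q ρ h n x θ := by
  have hn0 : (n : ℝ≥0∞) ≠ 0 := by exact_mod_cast (by omega : n ≠ 0)
  have hn' : (0 : ℝ) < n := by exact_mod_cast hn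
  rw [profile_eq_iInf hρ hn]
  refine le_iInf₂ fun K hK => ?_
  have := hK.prob
  -- An infinite cost leaves nothing to prove. Otherwise the hypothesis can be integrated against
  -- each `K i`, and the terms in `ℓ` cancel in the sum by feasibility.
  by_cases htop : ∃ i ∈ Finset.range n, ∫⁻ u, ENNReal.ofReal (cost q ρ u (x i)) ∂(K i) = ∞
  · have : kernelCost q ρ n x K = ∞ := by
      rw [kernelCost, ENNReal.sum_eq_top.2 htop]
      exact ENNReal.mul_top (by simp)
    rw [this]; exact le_top
  · push Not at htop
    have hci : ∀ i ∈ Finset.range n, Integrable (fun u => cost q ρ u (x i)) (K i) := by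
      intro i hi
      refine ⟨(continuous_cost_left hρ (x i)).measurable.aestronglyMeasurable, ?_⟩
      rw [hasFiniteIntegral_iff_ofReal (ae_of_all _ fun u => cost_nonneg u _)]
      exact (htop i hi).lt_top
    have hcost : kernelCost q ρ n x K
        = ENNReal.ofReal ((n : ℝ)⁻¹ * ∑ i ∈ Finset.range n, ∫ u, cost q ρ u (x i) ∂(K i)) := by
      rw [ENNReal.ofReal_mul (by positivity), ENNReal.ofReal_inv_of_pos hn',
        ENNReal.ofReal_natCast, kernelCost, ENNReal.ofReal_sum_of_nonneg fun i _ =>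
          integral_nonneg fun u => cost_nonneg _ _]
      congr 1
      refine Finset.sum_congr rfl fun i hi => ?_
      rw [ofReal_integral_eq_lintegral_ofReal (hci i hi) (ae_of_all _ fun u => cost_nonneg _ _)]
    rw [hcost]
    refine ENNReal.ofReal_le_ofReal (mul_le_mul_of_nonneg_left ?_ (by positivity))
    have h1 : ∀ i ∈ Finset.range n,
        f i ≤ ∫ u, cost q ρ u (x i) ∂(K i) + ℓ (∫ u, h u θ ∂(K i)) := by
      intro i hi
      have hli := ℓ.integrable_comp (hK.integrable i hi)
      rw [← ContinuousLinearMap.integral_comp_comm ℓ (hK.integrable i hi),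
        ← integral_add (hci i hi) hli]
      have := integral_mono (μ := K i) (integrable_const (f i)) ((hci i hi).add hli) (hf i hi)
      simpa using this
    refine (Finset.sum_le_sum h1).trans (le_of_eq ?_)
    rw [Finset.sum_add_distrib, ← map_sum, hK.sum_eq_zero, map_zero, add_zero]

end Profile

/-! ### Strong law, central limit theorem and a Slutsky argument. -/

section LimitTheorems

variable {Ω Ω' : Type*} [MeasurableSpace Ω] [MeasurableSpace Ω'] {μ : Measure Ω}
  [IsProbabilityMeasure μ] {μ' : Measure Ω'} [IsProbabilityMeasure μ'] {m r : ℕ}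
  {ν : Measure (EuclideanSpace ℝ (Fin m))} {X : ℕ → Ω → EuclideanSpace ℝ (Fin m)}

/-- The strong law of large numbers for a function of an i.i.d. sample. -/
lemma strong_law_sample {G : Type*} [NormedAddCommGroup G] [NormedSpace ℝ G] [CompleteSpace G]
    [MeasurableSpace G] [BorelSpace G] (hindep : iIndepFun X μ) (hX : ∀ i, HasLaw (X i) ν μ)
    {f : EuclideanSpace ℝ (Fin m) → G} (hf : Measurable f) (hfi : Integrable f ν) :
    ∀ᵐ ω ∂μ, Tendsto (fun n : ℕ => (n : ℝ)⁻¹ • ∑ i ∈ Finset.range n, f (X i ω)) atTop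
      (𝓝 (∫ w, f w ∂ν)) := by
  have hid : ∀ i, IdentDistrib (X i) (X 0) μ μ := fun i =>
    ⟨(hX i).aemeasurable, (hX 0).aemeasurable, (hX i).map_eq.trans (hX 0).map_eq.symm⟩
  have h0 : Integrable (f ∘ X 0) μ := by
    have := hfi
    rw [← (hX 0).map_eq] at this
    exact this.comp_aemeasurable (hX 0).aemeasurable
  have hmean : ∫ ω, f (X 0 ω) ∂μ = ∫ w, f w ∂ν := by
    rw [← (hX 0).map_eq, integral_map (hX 0).aemeasurable]
    rw [(hX 0).map_eq]; exact hfi.aestronglyMeasurable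
  rw [← hmean]
  exact strong_law_ae (fun i => f ∘ X i) h0
    (fun i j hij => (hindep.indepFun hij).comp hf hf) fun i => (hid i).comp hf

lemma posSemidef_secondMoment {Y : EuclideanSpace ℝ (Fin m) → EuclideanSpace ℝ (Fin r)}
    (hY : MemLp Y 2 ν) :
    (secondMoment Y ν id).PosSemidef ∧ ∀ t : EuclideanSpace ℝ (Fin r),
      t.ofLp ⬝ᵥ (secondMoment Y ν id).mulVec t.ofLp = ∫ w, (inner ℝ (Y w) t) ^ 2 ∂ν := by
  have hcoord : ∀ i, MemLp (fun w => Y w i) 2 ν := fun i => by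
    have := hY.inner_const (𝕜 := ℝ) (EuclideanSpace.single i (1 : ℝ))
    simpa [EuclideanSpace.inner_single_right] using this
  have hprod : ∀ i j, Integrable (fun w => Y w i * Y w j) ν := fun i j =>
    (hcoord i).integrable_mul (hcoord j)
  have key : ∀ t : EuclideanSpace ℝ (Fin r),
      t.ofLp ⬝ᵥ (secondMoment Y ν id).mulVec t.ofLp = ∫ w, (inner ℝ (Y w) t) ^ 2 ∂ν := by
    intro t
    have e : ∀ w, (inner ℝ (Y w) t) ^ 2 = ∑ i, ∑ j, t i * t j * (Y w i * Y w j) := by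
      intro w
      rw [PiLp.inner_apply, sq, Finset.sum_mul_sum]
      refine Finset.sum_congr rfl fun i _ => Finset.sum_congr rfl fun j _ => ?_
      simp only [RCLike.inner_apply, conj_trivial]
      ring
    simp only [e]
    rw [integral_finsetSum _ fun i _ => integrable_finsetSum _ fun j _ => (hprod i j).const_mul _]
    simp only [dotProduct, Matrix.mulVec]
    refine Finset.sum_congr rfl fun i _ => ?_
    rw [integral_finsetSum _ fun j _ => (hprod i j).const_mul _, Finset.mul_sum]
    refine Finset.sum_congr rfl fun j _ => ?_
    rw [integral_const_mul]
    simp only [secondMoment, Matrix.of_apply, id]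
    ring
  refine ⟨Matrix.PosSemidef.of_dotProduct_mulVec_nonneg ?_ fun t => ?_, key⟩
  · ext i j
    simp [secondMoment, Matrix.conjTranspose_apply, mul_comm]
  · rw [star_trivial]
    exact (key (WithLp.toLp 2 t)).symm ▸ integral_nonneg fun w => sq_nonneg _

/-- The multivariate central limit theorem for a function of an i.i.d. sample. -/
lemma central_limit_sample (hindep : iIndepFun X μ) (hX : ∀ i, HasLaw (X i) ν μ)
    {g : EuclideanSpace ℝ (Fin m) → EuclideanSpace ℝ (Fin r)} (hg : Measurable g)
    (hg2 : MemLp g 2 ν) (hg0 : ∫ w, g w ∂ν = 0) {H : Ω' → EuclideanSpace ℝ (Fin r)}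
    (hH : HasLaw H (multivariateGaussian 0 (secondMoment g ν id)) μ') :
    TendstoInDistribution (fun (n : ℕ) ω => (√(n : ℝ))⁻¹ • ∑ i ∈ Finset.range n, g (X i ω)) atTop H
      (fun _ => μ) μ' := by
  have hid : ∀ i, IdentDistrib (X i) (X 0) μ μ := fun i =>
    ⟨(hX i).aemeasurable, (hX 0).aemeasurable, (hX i).map_eq.trans (hX 0).map_eq.symm⟩
  have hνprob : IsProbabilityMeasure ν := by
    rw [← (hX 0).map_eq]; exact Measure.isProbabilityMeasure_map (hX 0).aemeasurable
  have hmeas : ∀ i, AEMeasurable (fun ω => g (X i ω)) μ := fun i =>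
    hg.comp_aemeasurable (hX i).aemeasurable
  have hZ : ∀ n : ℕ, AEMeasurable
      (fun ω => (√(n : ℝ))⁻¹ • ∑ i ∈ Finset.range n, g (X i ω)) μ := fun n =>
    (Finset.aemeasurable_fun_sum (Finset.range n) fun i _ => hmeas i).fun_const_smul _
  refine ⟨hZ, hH.aemeasurable, ?_⟩
  refine ProbabilityMeasure.tendsto_iff_tendsto_charFun.2 fun t => ?_
  -- Cramér–Wold: the characteristic function of the vector sum at `t` is that of the projected sum
  -- at `1`, so the scalar theorem suffices.
  set f : EuclideanSpace ℝ (Fin m) → ℝ := fun w => inner ℝ (g w) t with hf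
  have hfm : Measurable f := hg.inner_const
  have hf2 : MemLp f 2 ν := hg2.inner_const t
  have hf0 : ∫ w, f w ∂ν = 0 := by
    have h1 := integral_inner (𝕜 := ℝ) (hg2.integrable (by norm_num)) t
    rw [hg0, inner_zero_right] at h1
    simpa only [hf, real_inner_comm] using h1
  have hmap : ∀ i, μ.map (X i) = ν := fun i => (hX i).map_eq
  have hmean : ∫ ω, f (X 0 ω) ∂μ = 0 := by
    rw [← hf0, ← hmap 0, integral_map (hX 0).aemeasurable hfm.aestronglyMeasurable]
  have hL2 : MemLp (fun ω => f (X 0 ω)) 2 μ := by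
    have : MemLp f 2 (μ.map (X 0)) := by rwa [hmap 0]
    exact (memLp_map_measure_iff hfm.aestronglyMeasurable (hX 0).aemeasurable).1 this
  have hvar : Var[fun ω => f (X 0 ω); μ]
      = t.ofLp ⬝ᵥ (secondMoment g ν id).mulVec t.ofLp := by
    have hfX : AEMeasurable (fun ω => f (X 0 ω)) μ := hfm.comp_aemeasurable (hX 0).aemeasurable
    rw [variance_of_integral_eq_zero hfX hmean,
      (posSemidef_secondMoment hg2).2 t]
    rw [← hmap 0, integral_map (hX 0).aemeasurable (hfm.pow_const 2).aestronglyMeasurable]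
  have hclt := tendstoInDistribution_inv_sqrt_mul_sum_sub (P := μ)
    (X := fun i ω => f (X i ω)) (Y := id)
    (P' := gaussianReal 0 Var[fun ω => f (X 0 ω); μ].toNNReal) HasLaw.id hL2
    (hindep.comp (fun _ => f) fun _ => hfm) (fun i => (hid i).comp hfm)
  have hchar := (ProbabilityMeasure.tendsto_iff_tendsto_charFun.1 hclt.tendsto) 1
  have e1 : charFun (μ'.map H) t
      = charFun ((gaussianReal 0 Var[fun ω => f (X 0 ω); μ].toNNReal).map id) 1 := by
    rw [hH.map_eq, Measure.map_id, charFun_gaussianReal,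
      charFun_multivariateGaussian (posSemidef_secondMoment hg2).1, ← hvar,
      Real.coe_toNNReal _ (variance_nonneg _ _)]
    simp
  have e2 : ∀ n : ℕ, charFun (μ.map fun ω => (√(n : ℝ))⁻¹ • ∑ i ∈ Finset.range n, g (X i ω)) t
      = charFun (μ.map fun ω => (√(n : ℝ))⁻¹ * (∑ i ∈ Finset.range n, f (X i ω)
        - n * μ[fun ω => f (X 0 ω)])) 1 := by
    intro n
    rw [charFun_apply, charFun_apply, integral_map (hZ n) (by fun_prop),
      integral_map (hclt.forall_aemeasurable n) (by fun_prop)]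
    refine integral_congr_ae (ae_of_all _ fun ω => ?_)
    simp only [hmean]
    rw [mul_zero, sub_zero, real_inner_smul_left, sum_inner]
    simp [hf]
  simp only [ProbabilityMeasure.coe_mk] at hchar ⊢
  rw [e1]
  simp only [e2]
  exact hchar

/-- A sequence that almost surely eventually follows a continuous function `G` of a sequence
converging in distribution, as long as the latter stays bounded, converges in distribution. -/
lemma tendstoInDistribution_of_eventually_close {F : Type*} [NormedAddCommGroup F]
    [MeasurableSpace F] [BorelSpace F] {Z : ℕ → Ω → F} {H : Ω' → F}
    {Y : ℕ → Ω → ℝ} {G : F → ℝ} (hG : Continuous G)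
    (hZ : TendstoInDistribution Z atTop H (fun _ => μ) μ') (hY : ∀ n, AEMeasurable (Y n) μ)
    (hclose : ∀ R ε : ℝ, 0 < ε → ∀ᵐ ω ∂μ, ∀ᶠ n in atTop, ‖Z n ω‖ ≤ R → |Y n ω - G (Z n ω)| ≤ ε) :
    TendstoInDistribution Y atTop (fun ω' => G (H ω')) (fun _ => μ) μ' := by
  refine tendstoInDistribution_of_tendstoInMeasure_sub Y _ (hZ.continuous_comp hG) ?_ hY
  -- On the event `‖Z n‖ ≤ R` the difference vanishes almost surely in the limit, hence in measure.
  -- The complementary event is handled by tightness.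
  have htrunc : ∀ R : ℝ, TendstoInMeasure μ
      (fun n ω => if ‖Z n ω‖ ≤ R then Y n ω - G (Z n ω) else 0) atTop 0 := by
    intro R
    refine tendstoInMeasure_of_tendsto_ae (fun n => ?_) ?_
    · have h1 : AEMeasurable (fun ω => (Z n ω, Y n ω)) μ :=
        (hZ.forall_aemeasurable n).prodMk (hY n)
      have h2 : Measurable fun z : F × ℝ => if ‖z.1‖ ≤ R then z.2 - G z.1 else 0 :=
        Measurable.ite (measurableSet_le measurable_fst.norm measurable_const)
          (measurable_snd.sub (hG.measurable.comp measurable_fst)) measurable_const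
      exact (h2.comp_aemeasurable h1).aestronglyMeasurable
    · have hall : ∀ᵐ ω ∂μ, ∀ k : ℕ, ∀ᶠ n in atTop,
          ‖Z n ω‖ ≤ R → |Y n ω - G (Z n ω)| ≤ 1 / ((k : ℝ) + 1) :=
        ae_all_iff.2 fun k => hclose R _ (by positivity)
      filter_upwards [hall] with ω hω
      rw [Metric.tendsto_atTop]
      intro ε hε
      obtain ⟨k, hk⟩ := exists_nat_one_div_lt hε
      obtain ⟨N, hN⟩ := eventually_atTop.1 (hω k)
      refine ⟨N, fun n hn => ?_⟩
      simp only [Pi.zero_apply, dist_zero_right, Real.norm_eq_abs]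
      split_ifs with hR
      · exact (hN n hn hR).trans_lt hk
      · simpa using hε
  rw [tendstoInMeasure_iff_measureReal_norm]
  intro ε hε
  rw [Metric.tendsto_atTop]
  intro η hη
  obtain ⟨R, hR⟩ : ∃ R : ℕ, (μ'.map H).real {x | (R : ℝ) ≤ ‖x‖} < η / 2 := by
    have : IsProbabilityMeasure (μ'.map H) := Measure.isProbabilityMeasure_map hZ.aemeasurable_limit
    have hlim : Tendsto (fun R : ℕ => (μ'.map H) {x | (R : ℝ) ≤ ‖x‖}) atTop (𝓝 0) := by
      have hempty : (⋂ R : ℕ, {x : F | (R : ℝ) ≤ ‖x‖}) = ∅ := by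
        ext x
        simp only [mem_iInter, mem_ofPred_eq, mem_empty_iff_false, iff_false, not_forall, not_le]
        exact exists_nat_gt ‖x‖
      rw [← measure_empty (μ := μ'.map H), ← hempty]
      refine tendsto_measure_iInter_atTop (fun R => ?_) (fun a b hab x hx => ?_)
        ⟨0, measure_ne_top _ _⟩
      · exact (measurableSet_le measurable_const measurable_norm).nullMeasurableSet
      · have hab' : (a : ℝ) ≤ b := by exact_mod_cast hab
        have hx' : (b : ℝ) ≤ ‖x‖ := hx
        exact hab'.trans hx'
    have h2 := (ENNReal.tendsto_toReal (by simp)).comp hlim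
    obtain ⟨R, hR⟩ := (h2.eventually_lt_const (u := η / 2) (by simpa using hη)).exists
    exact ⟨R, hR⟩
  -- The portmanteau theorem bounds the limsup of the probabilities of a closed set by its
  -- probability under the limit.
  have htight : ∀ᶠ n in atTop, μ.real {ω | (R : ℝ) ≤ ‖Z n ω‖} < η / 2 := by
    have hclosed : IsClosed {x : F | (R : ℝ) ≤ ‖x‖} := isClosed_le continuous_const continuous_norm
    have hls := ProbabilityMeasure.limsup_measure_closed_le_of_tendsto hZ.tendsto hclosed
    simp only [ProbabilityMeasure.coe_mk] at hls
    have hlt : (μ'.map H) {x | (R : ℝ) ≤ ‖x‖} < ENNReal.ofReal (η / 2) := by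
      have : IsProbabilityMeasure (μ'.map H) :=
        Measure.isProbabilityMeasure_map hZ.aemeasurable_limit
      exact (ENNReal.lt_ofReal_iff_toReal_lt (measure_ne_top _ _)).2 hR
    filter_upwards [eventually_lt_of_limsup_lt (hls.trans_lt hlt)] with n hn
    rw [Measure.map_apply_of_aemeasurable (hZ.forall_aemeasurable n) hclosed.measurableSet] at hn
    exact (ENNReal.lt_ofReal_iff_toReal_lt (measure_ne_top _ _)).1 hn
  obtain ⟨N₁, hN₁⟩ := eventually_atTop.1 htight
  obtain ⟨N₂, hN₂⟩ := Metric.tendsto_atTop.1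
    ((tendstoInMeasure_iff_measureReal_norm.1 (htrunc R)) ε hε) (η / 2) (half_pos hη)
  refine ⟨max N₁ N₂, fun n hn => ?_⟩
  have h1 := hN₁ n (le_trans (le_max_left _ _) hn)
  have h2 := hN₂ n (le_trans (le_max_right _ _) hn)
  rw [Real.dist_eq, sub_zero, abs_of_nonneg measureReal_nonneg] at h2 ⊢
  have hsub : {ω | ε ≤ ‖(Y - fun n => G ∘ Z n) n ω - (0 : Ω → ℝ) ω‖}
      ⊆ {ω | (R : ℝ) ≤ ‖Z n ω‖}
        ∪ {ω | ε ≤ ‖(if ‖Z n ω‖ ≤ R then Y n ω - G (Z n ω) else 0) - (0 : Ω → ℝ) ω‖} := by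
    intro ω hω
    rcases le_total (R : ℝ) ‖Z n ω‖ with h | h
    · exact Or.inl h
    · refine Or.inr ?_
      simp only [mem_ofPred_eq, if_pos h]
      exact hω
  calc _ ≤ _ := measureReal_mono hsub
    _ ≤ _ := measureReal_union_le _ _
    _ < η := by linarith

end LimitTheorems

/-! ### Growth of the derivative and the Taylor remainder. -/

section Remainder

variable {m r : ℕ} {p q : ℝ≥0∞} [Fact (1 ≤ p)] [Fact (1 ≤ q)] {ρ : ℝ}
  {g : EuclideanSpace ℝ (Fin m) → EuclideanSpace ℝ (Fin r)}

/-- The derivative of `g` grows at most like `‖w‖_q ^ (ρ - 1)`. -/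
lemma exists_norm_fderiv_le (hC1 : ContDiff ℝ 1 g) {κ : ℝ} (hκ : 0 < κ)
    (hgrowth : ∀ w : EuclideanSpace ℝ (Fin m), 1 ≤ vecNorm q w.ofLp →
      matNorm p (jacobian g w) ≤ κ * vecNorm q w.ofLp ^ (ρ - 1)) :
    ∃ C : ℝ, 0 < C ∧ ∀ w, ‖fderiv ℝ g w‖ ≤ C * (1 + vecNorm q w.ofLp ^ (ρ - 1)) := by
  obtain ⟨Cm, hCm, hmat⟩ := exists_norm_le_matNorm (p := p) (m := m) (r := r)
  obtain ⟨Cv, hCv, hvec⟩ := exists_norm_le_vecNorm q m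
  -- The Euclidean ball of radius `Cv` contains the unit `ℓ_q` ball, inside which the growth
  -- condition says nothing and compactness takes over.
  obtain ⟨B, hB⟩ := (isCompact_closedBall (0 : EuclideanSpace ℝ (Fin m)) Cv).exists_bound_of_continuousOn
    (hC1.continuous_fderiv (by norm_num)).continuousOn
  have hB0 : 0 ≤ B := (norm_nonneg _).trans (hB 0 (by simp [hCv.le]))
  refine ⟨B + Cm * κ, by positivity, fun w => ?_⟩
  have hN : 0 ≤ vecNorm q w.ofLp ^ (ρ - 1) := Real.rpow_nonneg (vecNorm_nonneg q _) _
  have hCκ : 0 < Cm * κ := by positivity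
  rcases le_total 1 (vecNorm q w.ofLp) with h | h
  · have h1 : ‖fderiv ℝ g w‖ ≤ Cm * (κ * vecNorm q w.ofLp ^ (ρ - 1)) :=
      (hmat _).trans (mul_le_mul_of_nonneg_left (hgrowth w h) hCm.le)
    nlinarith [mul_nonneg hB0 hN]
  · have h1 := hB w (by
      simp only [Metric.mem_closedBall, dist_zero_right]
      exact (hvec w).trans (mul_le_of_le_one_right hCv.le h))
    nlinarith [mul_nonneg hB0 hN, mul_nonneg hCκ.le hN]

lemma vecNorm_sub_le_of_mem_segment {w Δ v : EuclideanSpace ℝ (Fin m)}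
    (hv : v ∈ segment ℝ w (w + Δ)) : vecNorm q (v - w).ofLp ≤ vecNorm q Δ.ofLp := by
  rw [segment_eq_image'] at hv
  obtain ⟨s, hs, rfl⟩ := hv
  simp only [add_sub_cancel_left, WithLp.ofLp_smul, vecNorm_smul, abs_of_nonneg hs.1]
  exact mul_le_of_le_one_left (vecNorm_nonneg q _) hs.2

/-- The first-order Taylor remainder of `g`. -/
lemma exists_remainder_le (hρ : 1 < ρ) (hC1 : ContDiff ℝ 1 g) {κ : ℝ} (hκ : 0 < κ)
    (hgrowth : ∀ w : EuclideanSpace ℝ (Fin m), 1 ≤ vecNorm q w.ofLp →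
      matNorm p (jacobian g w) ≤ κ * vecNorm q w.ofLp ^ (ρ - 1))
    {κbar : EuclideanSpace ℝ (Fin m) → ℝ} (hκbar : ∀ w, 0 ≤ κbar w)
    (hlip : ∀ w Δ : EuclideanSpace ℝ (Fin m), vecNorm q Δ.ofLp ≤ 1 →
      matNorm p (jacobian g (w + Δ) - jacobian g w) ≤ κbar w * vecNorm q Δ.ofLp) :
    ∃ C : ℝ, 0 < C ∧ ∀ w Δ : EuclideanSpace ℝ (Fin m),
      ‖g (w + Δ) - g w - fderiv ℝ g w Δ‖
        ≤ C * (κbar w + 1 + vecNorm q w.ofLp ^ (ρ - 1))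
            * (vecNorm q Δ.ofLp * min 1 (vecNorm q Δ.ofLp)) + C * vecNorm q Δ.ofLp ^ ρ := by
  obtain ⟨Cm, hCm, hmat⟩ := exists_norm_le_matNorm (p := p) (m := m) (r := r)
  obtain ⟨Cv, hCv, hvec⟩ := exists_norm_le_vecNorm q m
  obtain ⟨C0, hC0, hder⟩ := exists_norm_fderiv_le (p := p) (q := q) hC1 hκ hgrowth
  have hE : (0 : ℝ) < 2 ^ (ρ - 1) := by positivity
  -- The first summand serves displacements of length at most one, through the Lipschitz condition.
  -- The second serves longer ones, through the growth of the derivative along the segment.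
  refine ⟨Cm * Cv + C0 * Cv * (2 + 2 ^ (ρ - 1)), by positivity, fun w Δ => ?_⟩
  have hdiff : ∀ v ∈ segment ℝ w (w + Δ), DifferentiableAt ℝ g v := fun v _ =>
    (hC1.differentiable (by norm_num)) v
  have hNΔ := vecNorm_nonneg q Δ.ofLp
  have hNw : 0 ≤ vecNorm q w.ofLp ^ (ρ - 1) := Real.rpow_nonneg (vecNorm_nonneg q _) _
  have hκw := hκbar w
  have hNρ : 0 ≤ vecNorm q Δ.ofLp ^ ρ := Real.rpow_nonneg hNΔ _
  have hmean : ∀ A : ℝ, (∀ v ∈ segment ℝ w (w + Δ), ‖fderiv ℝ g v - fderiv ℝ g w‖ ≤ A) →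
      ‖g (w + Δ) - g w - fderiv ℝ g w Δ‖ ≤ A * (Cv * vecNorm q Δ.ofLp) := by
    intro A hA
    have h1 := Convex.norm_image_sub_le_of_norm_fderiv_le' hdiff hA (convex_segment w (w + Δ))
      (left_mem_segment ℝ _ _) (right_mem_segment ℝ _ _)
    rw [add_sub_cancel_left] at h1
    have hA0 : 0 ≤ A := (norm_nonneg _).trans (hA w (left_mem_segment ℝ _ _))
    exact h1.trans (mul_le_mul_of_nonneg_left (hvec Δ) hA0)
  rcases le_or_gt (vecNorm q Δ.ofLp) 1 with h | h
  · rw [min_eq_right h]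
    refine (hmean (Cm * (κbar w * vecNorm q Δ.ofLp)) fun v hv => ?_).trans ?_
    · have hseg := vecNorm_sub_le_of_mem_segment (q := q) hv
      have h2 := hlip w (v - w) (hseg.trans h)
      rw [add_sub_cancel] at h2
      have h3 : Matrix.of (fun i j => ((fderiv ℝ g v - fderiv ℝ g w) (EuclideanSpace.single j 1)) i)
          = jacobian g v - jacobian g w := by
        ext i j
        simp [jacobian]
      refine (hmat _).trans (mul_le_mul_of_nonneg_left ?_ hCm.le)
      rw [h3]
      exact h2.trans (mul_le_mul_of_nonneg_left hseg hκw)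
    · set τ := vecNorm q Δ.ofLp
      have h4 : 0 ≤ Cm * Cv * (1 + vecNorm q w.ofLp ^ (ρ - 1)) * (τ * τ) := by positivity
      have h5 : 0 ≤ C0 * Cv * (2 + 2 ^ (ρ - 1)) * (κbar w + 1 + vecNorm q w.ofLp ^ (ρ - 1))
          * (τ * τ) := by positivity
      have h6 : 0 ≤ (Cm * Cv + C0 * Cv * (2 + 2 ^ (ρ - 1))) * τ ^ ρ := by positivity
      linarith
  · rw [min_eq_left h.le, mul_one]
    set τ := vecNorm q Δ.ofLp
    set ω := vecNorm q w.ofLp ^ (ρ - 1)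
    refine (hmean (C0 * (2 + (2 ^ (ρ - 1) + 1) * ω + 2 ^ (ρ - 1) * τ ^ (ρ - 1)))
      fun v hv => ?_).trans ?_
    · have hseg := vecNorm_sub_le_of_mem_segment (q := q) hv
      have h1 : vecNorm q v.ofLp ≤ vecNorm q w.ofLp + τ := by
        have := vecNorm_add_le q w.ofLp (v - w).ofLp
        rw [← WithLp.ofLp_add, add_sub_cancel] at this
        linarith
      have h2 : vecNorm q v.ofLp ^ (ρ - 1) ≤ 2 ^ (ρ - 1) * (ω + τ ^ (ρ - 1)) :=
        (Real.rpow_le_rpow (vecNorm_nonneg q _) h1 (by linarith)).trans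
          (rpow_add_le_two_mul (vecNorm_nonneg q _) hNΔ (by linarith))
      have h3 := norm_sub_le (fderiv ℝ g v) (fderiv ℝ g w)
      have h4 := (hder v).trans (mul_le_mul_of_nonneg_left (add_le_add_right h2 1) hC0.le)
      have h5 := hder w
      refine (h3.trans (add_le_add h4 h5)).trans (le_of_eq ?_)
      ring
    · have e : τ ^ (ρ - 1) * τ = τ ^ ρ := by
        rw [← Real.rpow_add_one (by linarith), sub_add_cancel]
      have h4 : 0 ≤ Cm * Cv * (κbar w + 1 + ω) * τ := by positivity
      have h5 : 0 ≤ Cm * Cv * τ ^ ρ := by positivity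
      have h6 : 0 ≤ C0 * Cv * (2 + 2 ^ (ρ - 1)) * κbar w * τ := by positivity
      have h7 : 0 ≤ C0 * Cv * 2 * τ ^ ρ := by positivity
      have h8 : 0 ≤ C0 * Cv * 2 ^ (ρ - 1) * τ := by positivity
      have h9 : 0 ≤ C0 * Cv * ω * τ := by positivity
      calc C0 * (2 + (2 ^ (ρ - 1) + 1) * ω + 2 ^ (ρ - 1) * τ ^ (ρ - 1)) * (Cv * τ)
          = C0 * Cv * (2 + (2 ^ (ρ - 1) + 1) * ω) * τ
            + C0 * Cv * 2 ^ (ρ - 1) * (τ ^ (ρ - 1) * τ) := by ring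
        _ = C0 * Cv * (2 + (2 ^ (ρ - 1) + 1) * ω) * τ + C0 * Cv * 2 ^ (ρ - 1) * τ ^ ρ := by
          rw [e]
        _ ≤ _ := by linarith

end Remainder

/-! ### The integrable envelope of the inner optimisation. -/

section Envelope

/-- An integrable majorant for the inner maximisation of the dual problem. -/
noncomputable def envelope (ρ η K a b : ℝ) : ℝ :=
  (ρ - 1) * (((1 - η) ^ (1 / ρ))⁻¹ * (a + η * b)) ^ (ρ / (ρ - 1))
    + if K ≤ a + b then (ρ - 1) * (((1 - η) ^ (1 / ρ))⁻¹ * (a + b)) ^ (ρ / (ρ - 1)) else 0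

/-- In the application `s = √n` and `τ` is the length of a displacement. The term with `C` is
absorbed by a fraction `η` of the transport cost. For `τ ≤ η` the term with `b` adds at most `η * b`
to the slope, and Young applies. For `τ > η` either `a + b ≥ K`, which the second summand of the
envelope pays for, or the remaining cost already dominates because `s` is large. -/
lemma le_envelope {ρ η K a b C s τ : ℝ} (hρ : 1 < ρ) (hη0 : 0 < η) (hη1 : η < 1) (ha : 0 ≤ a)
    (hb : 0 ≤ b) (hs : 0 < s) (hτ : 0 ≤ τ) (h1 : ρ * C * s ≤ η * s ^ ρ)
    (h2 : ρ * K ≤ (1 - η) * (η * s) ^ (ρ - 1)) :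
    ρ * s * (a * τ + b * (τ * min 1 τ) + C * τ ^ ρ) ≤ s ^ ρ * τ ^ ρ + envelope ρ η K a b := by
  have hτρ : 0 ≤ τ ^ ρ := Real.rpow_nonneg hτ _
  have ht : 0 ≤ s * τ := by positivity
  have e : s ^ ρ * τ ^ ρ = (s * τ) ^ ρ := (Real.mul_rpow hs.le hτ).symm
  have hC : ρ * s * (C * τ ^ ρ) ≤ η * (s * τ) ^ ρ := by
    rw [← e]
    calc ρ * s * (C * τ ^ ρ) = (ρ * C * s) * τ ^ ρ := by ring
      _ ≤ η * s ^ ρ * τ ^ ρ := mul_le_mul_of_nonneg_right h1 hτρ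
      _ = _ := by ring
  have hF1 : 0 ≤ (ρ - 1) * (((1 - η) ^ (1 / ρ))⁻¹ * (a + η * b)) ^ (ρ / (ρ - 1)) := by
    have : 0 < 1 - η := by linarith
    have : 0 ≤ ρ - 1 := by linarith
    positivity
  have hF2 : 0 ≤ (ρ - 1) * (((1 - η) ^ (1 / ρ))⁻¹ * (a + b)) ^ (ρ / (ρ - 1)) := by
    have : 0 < 1 - η := by linarith
    have : 0 ≤ ρ - 1 := by linarith
    positivity
  have hF3 : 0 ≤ if K ≤ a + b then
      (ρ - 1) * (((1 - η) ^ (1 / ρ))⁻¹ * (a + b)) ^ (ρ / (ρ - 1)) else 0 := by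
    split_ifs
    · exact hF2
    · exact le_rfl
  rw [e]
  suffices h : ρ * ((a + b * min 1 τ) * (s * τ)) ≤ (1 - η) * (s * τ) ^ ρ + envelope ρ η K a b by
    calc ρ * s * (a * τ + b * (τ * min 1 τ) + C * τ ^ ρ)
        = ρ * ((a + b * min 1 τ) * (s * τ)) + ρ * s * (C * τ ^ ρ) := by ring
      _ ≤ _ := by linarith
  rcases le_or_gt τ η with hτη | hτη
  · have hy := young_weighted hρ (a := a + η * b) (by positivity) ht (by linarith : 0 < 1 - η)
    have hmin : min 1 τ ≤ η := (min_le_right _ _).trans hτη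
    have h3 : ρ * ((a + b * min 1 τ) * (s * τ)) ≤ ρ * ((a + η * b) * (s * τ)) := by
      have : b * min 1 τ ≤ η * b := by rw [mul_comm]; exact mul_le_mul_of_nonneg_right hmin hb
      gcongr
    rw [envelope]
    linarith
  · have h3 : ρ * ((a + b * min 1 τ) * (s * τ)) ≤ ρ * ((a + b) * (s * τ)) := by
      have : b * min 1 τ ≤ b := mul_le_of_le_one_right hb (min_le_left _ _)
      gcongr
    rw [envelope]
    by_cases hK : K ≤ a + b
    · have hy := young_weighted hρ (a := a + b) (by positivity) ht (by linarith : 0 < 1 - η)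
      rw [if_pos hK]
      linarith
    · rw [if_neg hK]
      push Not at hK
      have hτ' : 0 < τ := hη0.trans hτη
      have e2 : (s * τ) ^ ρ = (s * τ) ^ (ρ - 1) * (s * τ) := by
        rw [← Real.rpow_add_one (by positivity), sub_add_cancel]
      have h4 : (η * s) ^ (ρ - 1) ≤ (s * τ) ^ (ρ - 1) := by
        refine Real.rpow_le_rpow (by positivity) ?_ (by linarith)
        rw [mul_comm η]
        exact mul_le_mul_of_nonneg_left hτη.le hs.le
      have h5 : ρ * (a + b) ≤ (1 - η) * (s * τ) ^ (ρ - 1) := by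
        have h6 : ρ * (a + b) ≤ ρ * K := mul_le_mul_of_nonneg_left hK.le (by linarith)
        have h7 := mul_le_mul_of_nonneg_left h4 (by linarith : 0 ≤ 1 - η)
        linarith
      have h8 := mul_le_mul_of_nonneg_right h5 ht
      rw [e2]
      linarith

lemma measurable_envelope (ρ η K : ℝ) :
    Measurable fun z : ℝ × ℝ => envelope ρ η K z.1 z.2 := by
  unfold envelope
  refine Measurable.add (by fun_prop) (Measurable.ite ?_ (by fun_prop) measurable_const)
  exact measurableSet_le measurable_const (by fun_prop)

/-- The upper bound is free of `η` and `K`, so it dominates while both vary. -/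
lemma envelope_nonneg_le {ρ η K a b : ℝ} (hρ : 1 < ρ) (hη0 : 0 ≤ η) (hη1 : η ≤ 1 / 2) (ha : 0 ≤ a)
    (hb : 0 ≤ b) :
    0 ≤ envelope ρ η K a b ∧ envelope ρ η K a b
      ≤ 2 * (ρ - 1) * (((1 / 2 : ℝ) ^ (1 / ρ))⁻¹ * (a + b)) ^ (ρ / (ρ - 1)) := by
  have hη : 0 < 1 - η := by linarith
  have hρ1 : 0 ≤ ρ - 1 := by linarith
  have hs := (one_lt_dualExponent hρ).le
  have hinv : ((1 - η) ^ (1 / ρ))⁻¹ ≤ ((1 / 2 : ℝ) ^ (1 / ρ))⁻¹ := by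
    refine inv_anti₀ (by positivity) (Real.rpow_le_rpow (by norm_num) (by linarith) ?_)
    have : 0 < ρ := by linarith
    positivity
  have hab : a + η * b ≤ a + b := by nlinarith
  have hA : (((1 - η) ^ (1 / ρ))⁻¹ * (a + η * b)) ^ (ρ / (ρ - 1))
      ≤ (((1 / 2 : ℝ) ^ (1 / ρ))⁻¹ * (a + b)) ^ (ρ / (ρ - 1)) :=
    Real.rpow_le_rpow (by positivity) (by gcongr) (by linarith)
  have hB : (((1 - η) ^ (1 / ρ))⁻¹ * (a + b)) ^ (ρ / (ρ - 1))
      ≤ (((1 / 2 : ℝ) ^ (1 / ρ))⁻¹ * (a + b)) ^ (ρ / (ρ - 1)) :=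
    Real.rpow_le_rpow (by positivity) (by gcongr) (by linarith)
  have hA0 : 0 ≤ (((1 - η) ^ (1 / ρ))⁻¹ * (a + η * b)) ^ (ρ / (ρ - 1)) := by positivity
  have hB0 : 0 ≤ (((1 - η) ^ (1 / ρ))⁻¹ * (a + b)) ^ (ρ / (ρ - 1)) := by positivity
  have hC0 : 0 ≤ (((1 / 2 : ℝ) ^ (1 / ρ))⁻¹ * (a + b)) ^ (ρ / (ρ - 1)) := by positivity
  have hA' := mul_le_mul_of_nonneg_left hA hρ1
  have hB' := mul_le_mul_of_nonneg_left hB hρ1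
  have hA0' := mul_nonneg hρ1 hA0
  have hB0' := mul_nonneg hρ1 hB0
  have hC0' := mul_nonneg hρ1 hC0
  rw [envelope]
  split_ifs
  · exact ⟨by linarith, by linarith⟩
  · exact ⟨by linarith, by linarith⟩

/-- The first summand is continuous in `η` at zero, and the second vanishes once `j` exceeds `a +
b`. The shift by two keeps `η` at most `1 / 2`. -/
lemma tendsto_envelope {ρ : ℝ} (hρ : 1 < ρ) (a b : ℝ) :
    Tendsto (fun j : ℕ => envelope ρ (1 / ((j : ℝ) + 2)) j a b) atTop
      (𝓝 ((ρ - 1) * a ^ (ρ / (ρ - 1)))) := by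
  have hη : Tendsto (fun j : ℕ => 1 / ((j : ℝ) + 2)) atTop (𝓝 0) :=
    tendsto_const_nhds.div_atTop (tendsto_atTop_add_const_right _ _ tendsto_natCast_atTop_atTop)
  have hs := (one_lt_dualExponent hρ).le
  have hcont : ContinuousAt (fun η : ℝ =>
      (ρ - 1) * (((1 - η) ^ (1 / ρ))⁻¹ * (a + η * b)) ^ (ρ / (ρ - 1))) 0 := by
    refine continuousAt_const.mul (ContinuousAt.rpow_const ?_ (Or.inr (by linarith)))
    refine ContinuousAt.mul (ContinuousAt.inv₀ (ContinuousAt.rpow_const (by fun_prop)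
      (Or.inl (by norm_num))) (by simp)) (by fun_prop)
  have h1 := hcont.tendsto.comp hη
  simp only [sub_zero, Real.one_rpow, inv_one, zero_mul, add_zero, one_mul] at h1
  refine h1.congr' ?_
  filter_upwards [tendsto_natCast_atTop_atTop.eventually (eventually_gt_atTop (a + b))] with j hj
  simp [envelope, not_le.2 hj]

end Envelope

/-! ### The asymptotic lower bound. -/

section Asymptotics

variable {m l r : ℕ}

/-- The regularity of the estimating function `g` under the law `ν` on which the asymptotics of the
profile function depend. -/
structure IsRegular (p q : ℝ≥0∞) (ρ : ℝ) (ν : Measure (EuclideanSpace ℝ (Fin m)))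
    (g : EuclideanSpace ℝ (Fin m) → EuclideanSpace ℝ (Fin r))
    (b : EuclideanSpace ℝ (Fin m) → ℝ) (C : ℝ) : Prop where
  one_lt : 1 < ρ
  conjugate : p⁻¹ + q⁻¹ = 1
  contDiff : ContDiff ℝ 1 g
  memLp_two : MemLp g 2 ν
  integral_eq_zero : ∫ w, g w ∂ν = 0
  moment : Integrable (fun w => vecNorm q w.ofLp ^ ρ) ν
  nondegenerate : ∀ ℓ : EuclideanSpace ℝ (Fin r) →L[ℝ] ℝ,
    (∀ᵐ w ∂ν, ℓ.comp (fderiv ℝ g w) = 0) → ℓ = 0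
  integrable_fderiv : Integrable (fun w => ‖fderiv ℝ g w‖ ^ (ρ / (ρ - 1))) ν
  measurable_bound : Measurable b
  bound_nonneg : ∀ w, 0 ≤ b w
  integrable_bound : Integrable (fun w => b w ^ (ρ / (ρ - 1))) ν
  const_nonneg : 0 ≤ C
  remainder_le : ∀ w Δ : EuclideanSpace ℝ (Fin m), ‖g (w + Δ) - g w - fderiv ℝ g w Δ‖
    ≤ b w * (vecNorm q Δ.ofLp * min 1 (vecNorm q Δ.ofLp)) + C * vecNorm q Δ.ofLp ^ ρ

variable {p q : ℝ≥0∞} [Fact (1 ≤ p)] [Fact (1 ≤ q)] {ρ : ℝ}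
  {ν : Measure (EuclideanSpace ℝ (Fin m))} [IsProbabilityMeasure ν]
  {h : EuclideanSpace ℝ (Fin m) → EuclideanSpace ℝ (Fin l) → EuclideanSpace ℝ (Fin r)}
  {θ : EuclideanSpace ℝ (Fin l)} {b : EuclideanSpace ℝ (Fin m) → ℝ} {C : ℝ}

namespace IsRegular

variable {g : EuclideanSpace ℝ (Fin m) → EuclideanSpace ℝ (Fin r)}

lemma continuous_fderiv (hR : IsRegular p q ρ ν g b C) : Continuous (fderiv ℝ g) :=
  hR.contDiff.continuous_fderiv (by norm_num)

lemma integrable_norm_fderiv (hR : IsRegular p q ρ ν g b C) :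
    Integrable (fun w => ‖fderiv ℝ g w‖) ν :=
  integrable_norm_of_rpow (one_lt_dualExponent hR.one_lt).le hR.continuous_fderiv
    hR.integrable_fderiv

lemma integrable (hR : IsRegular p q ρ ν g b C) : Integrable g ν :=
  hR.memLp_two.integrable (by norm_num)

lemma integrable_bound_one (hR : IsRegular p q ρ ν g b C) : Integrable b ν := by
  refine Integrable.mono' ((integrable_const 1).add hR.integrable_bound)
    hR.measurable_bound.aestronglyMeasurable (ae_of_all _ fun w => ?_)
  rw [Real.norm_of_nonneg (hR.bound_nonneg w)]
  simp only [Pi.add_apply]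
  have h0 : 0 ≤ b w ^ (ρ / (ρ - 1)) := Real.rpow_nonneg (hR.bound_nonneg w) _
  rcases le_total (b w) 1 with h | h
  · linarith
  · have := Real.rpow_le_rpow_of_exponent_le h (one_lt_dualExponent hR.one_lt).le
    rw [Real.rpow_one] at this; linarith

/-- The limit of the scaled profile function as a function of the limit of the scaled mean of the
estimating function. -/
noncomputable def limitFunction (hR : IsRegular p q ρ ν g b C) : EuclideanSpace ℝ (Fin r) → ℝ :=
  valueFunction (meanEffect ν (fderiv ℝ g) hR.continuous_fderiv hR.integrable_norm_fderiv)
    (meanCost q ρ ν)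

lemma isGreatest_limitFunction (hR : IsRegular p q ρ ν g b C) (x : EuclideanSpace ℝ (Fin r)) :
    IsGreatest (range fun ℓ : EuclideanSpace ℝ (Fin r) →L[ℝ] ℝ =>
      ρ * ℓ x - conjugateCost p ρ ν (fderiv ℝ g) ℓ) (hR.limitFunction x) :=
  strong_duality hR.one_lt hR.conjugate hR.continuous_fderiv hR.integrable_norm_fderiv
    hR.integrable_fderiv hR.nondegenerate x

lemma surjective (hR : IsRegular p q ρ ν g b C) : Function.Surjective
    (meanEffect ν (fderiv ℝ g) hR.continuous_fderiv hR.integrable_norm_fderiv) :=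
  surjective_meanEffect _ _ hR.nondegenerate

lemma continuous_limitFunction (hR : IsRegular p q ρ ν g b C) : Continuous hR.limitFunction :=
  continuous_valueFunction hR.surjective meanCost_nonneg (convexOn_meanCost hR.one_lt)

lemma exists_envelope_close (hR : IsRegular p q ρ ν g b C)
    (ℓ : EuclideanSpace ℝ (Fin r) →L[ℝ] ℝ) {ε : ℝ} (hε : 0 < ε) :
    ∃ η K : ℝ, 0 < η ∧ η < 1 ∧
      Measurable (fun w => envelope ρ η K (dualNorm p (ℓ.comp (fderiv ℝ g w))) (‖ℓ‖ * b w)) ∧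
      Integrable (fun w => envelope ρ η K (dualNorm p (ℓ.comp (fderiv ℝ g w))) (‖ℓ‖ * b w)) ν ∧
      ∫ w, envelope ρ η K (dualNorm p (ℓ.comp (fderiv ℝ g w))) (‖ℓ‖ * b w) ∂ν
        < conjugateCost p ρ ν (fderiv ℝ g) ℓ + ε := by
  have hs := one_lt_dualExponent hR.one_lt
  have hρ := hR.one_lt
  set a : EuclideanSpace ℝ (Fin m) → ℝ := fun w => dualNorm p (ℓ.comp (fderiv ℝ g w)) with ha
  set b' : EuclideanSpace ℝ (Fin m) → ℝ := fun w => ‖ℓ‖ * b w with hb'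
  have ha0 : ∀ w, 0 ≤ a w := fun w => dualNorm_nonneg _
  have hb0 : ∀ w, 0 ≤ b' w := fun w => mul_nonneg (norm_nonneg _) (hR.bound_nonneg w)
  have ham : Measurable a := (continuous_dualNorm_comp hR.continuous_fderiv ℓ).measurable
  have hbm : Measurable b' := hR.measurable_bound.const_mul _
  have hai : Integrable (fun w => a w ^ (ρ / (ρ - 1))) ν :=
    integrable_dualNorm_rpow (by linarith) hR.continuous_fderiv hR.integrable_fderiv ℓ
  have hbi : Integrable (fun w => b' w ^ (ρ / (ρ - 1))) ν := by
    have : (fun w => b' w ^ (ρ / (ρ - 1))) = fun w => ‖ℓ‖ ^ (ρ / (ρ - 1)) * b w ^ (ρ / (ρ - 1)) :=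
      funext fun w => Real.mul_rpow (norm_nonneg _) (hR.bound_nonneg w)
    rw [this]
    exact hR.integrable_bound.const_mul _
  have hA : (0 : ℝ) < ((1 / 2 : ℝ) ^ (1 / ρ))⁻¹ := by positivity
  have hsum : Integrable (fun w => 2 * (ρ - 1) *
      (((1 / 2 : ℝ) ^ (1 / ρ))⁻¹ * (a w + b' w)) ^ (ρ / (ρ - 1))) ν := by
    refine Integrable.const_mul ?_ _
    refine Integrable.mono' (((hai.add hbi).const_mul (2 ^ (ρ / (ρ - 1)))).const_mul
      ((((1 / 2 : ℝ) ^ (1 / ρ))⁻¹) ^ (ρ / (ρ - 1))))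
      (((ham.add hbm).const_mul _).pow_const _).aestronglyMeasurable (ae_of_all _ fun w => ?_)
    have h0 : 0 ≤ a w + b' w := add_nonneg (ha0 w) (hb0 w)
    rw [Real.norm_of_nonneg (by positivity), Real.mul_rpow hA.le h0]
    exact mul_le_mul_of_nonneg_left (rpow_add_le_two_mul (ha0 w) (hb0 w) (by linarith))
      (by positivity)
  have hη : ∀ j : ℕ, 0 < 1 / ((j : ℝ) + 2) ∧ 1 / ((j : ℝ) + 2) ≤ 1 / 2 := fun j =>
    ⟨by positivity, one_div_le_one_div_of_le (by norm_num) (by linarith [j.cast_nonneg (α := ℝ)])⟩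
  have hem : ∀ η K : ℝ, Measurable fun w => envelope ρ η K (a w) (b' w) := fun η K =>
    (measurable_envelope ρ η K).comp (ham.prodMk hbm)
  have hbound : ∀ (j : ℕ) w, ‖envelope ρ (1 / ((j : ℝ) + 2)) j (a w) (b' w)‖ ≤
      2 * (ρ - 1) * (((1 / 2 : ℝ) ^ (1 / ρ))⁻¹ * (a w + b' w)) ^ (ρ / (ρ - 1)) := by
    intro j w
    have h1 := envelope_nonneg_le (K := j) hρ (hη j).1.le (hη j).2 (ha0 w) (hb0 w)
    rw [Real.norm_of_nonneg h1.1]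
    exact h1.2
  have hlim : Tendsto (fun j : ℕ => ∫ w, envelope ρ (1 / ((j : ℝ) + 2)) j (a w) (b' w) ∂ν) atTop
      (𝓝 (conjugateCost p ρ ν (fderiv ℝ g) ℓ)) := by
    rw [conjugateCost, ← integral_const_mul]
    exact tendsto_integral_of_dominated_convergence _
      (fun j => (hem _ _).aestronglyMeasurable) hsum (fun j => ae_of_all _ (hbound j))
      (ae_of_all _ fun w => tendsto_envelope hρ _ _)
  obtain ⟨j, hj⟩ := (hlim.eventually_lt_const (lt_add_of_pos_right _ hε)).exists
  exact ⟨1 / ((j : ℝ) + 2), j, (hη j).1, (hη j).2.trans_lt (by norm_num), hem _ _,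
    Integrable.mono' hsum (hem _ _).aestronglyMeasurable (ae_of_all _ (hbound j)), hj⟩

end IsRegular

lemma sqrt_rpow_eq (n : ℕ) : (√(n : ℝ)) ^ ρ = (n : ℝ) ^ (ρ / 2) := by
  rw [Real.sqrt_eq_rpow, ← Real.rpow_mul (Nat.cast_nonneg n)]
  congr 1; ring

/-- Weak duality with `ρ * s ^ (1 - ρ)` times `ℓ` as multiplier, where `s = √n`. At this scale the
linear gain and the transport cost balance at displacements of order `1 / s`, and the envelope
controls the minimum over `u`. -/
lemma profile_ge_of_envelope (hR : IsRegular p q ρ ν (fun w => h w θ) b C)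
    (ℓ : EuclideanSpace ℝ (Fin r) →L[ℝ] ℝ) {n : ℕ} (hn : 1 ≤ n)
    (x : ℕ → EuclideanSpace ℝ (Fin m)) {η K : ℝ} (hη0 : 0 < η) (hη1 : η < 1)
    (h1 : ρ * (‖ℓ‖ * C) * √(n : ℝ) ≤ η * √(n : ℝ) ^ ρ)
    (h2 : ρ * K ≤ (1 - η) * (η * √(n : ℝ)) ^ (ρ - 1)) :
    ρ * ℓ ((√(n : ℝ))⁻¹ • ∑ i ∈ Finset.range n, h (x i) θ)
      - (n : ℝ)⁻¹ * ∑ i ∈ Finset.range n, envelope ρ η K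
          (dualNorm p (ℓ.comp (fderiv ℝ (fun w => h w θ) (x i)))) (‖ℓ‖ * b (x i))
      ≤ (n : ℝ) ^ (ρ / 2) * (profile q ρ h n x θ).toReal := by
  have hρ := hR.one_lt
  have hn' : (0 : ℝ) < n := by exact_mod_cast hn
  set s := √(n : ℝ) with hs
  have hs0 : 0 < s := Real.sqrt_pos.2 hn'
  have hsρ : 0 < s ^ ρ := Real.rpow_pos_of_pos hs0 _
  have hss : (n : ℝ) = s * s := (Real.mul_self_sqrt hn'.le).symm
  set a : ℕ → ℝ := fun i => dualNorm p (ℓ.comp (fderiv ℝ (fun w => h w θ) (x i))) with ha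
  set f : ℕ → ℝ := fun i =>
    (s ^ ρ)⁻¹ * (ρ * s * ℓ (h (x i) θ) - envelope ρ η K (a i) (‖ℓ‖ * b (x i))) with hf
  have hle := le_profile_of_forall_le (q := q) (h := h) (θ := θ) (x := x) hρ hn
    (((s ^ ρ)⁻¹ * (ρ * s)) • ℓ) (f := f) (fun i _ u => by
      set Δ := u - x i with hΔ
      set τ := vecNorm q Δ.ofLp with hτ
      have hu : u = x i + Δ := by rw [hΔ, add_sub_cancel]
      have hτ0 : 0 ≤ τ := vecNorm_nonneg q _
      have hcost : cost q ρ u (x i) = τ ^ ρ := rfl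
      have hrem := hR.remainder_le (x i) Δ
      rw [← hu] at hrem
      have hlin : -ℓ (fderiv ℝ (fun w => h w θ) (x i) Δ) ≤ a i * τ := by
        have := le_dualNorm_mul hR.conjugate (ℓ.comp (fderiv ℝ (fun w => h w θ) (x i))) (-Δ)
        rw [WithLp.ofLp_neg, vecNorm_neg, map_neg] at this
        exact this
      have hℓrem : -ℓ (h u θ - h (x i) θ - fderiv ℝ (fun w => h w θ) (x i) Δ)
          ≤ ‖ℓ‖ * (b (x i) * (τ * min 1 τ) + C * τ ^ ρ) := by
        refine (neg_le_abs _).trans ((ℓ.le_opNorm _).trans ?_)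
        exact mul_le_mul_of_nonneg_left hrem (norm_nonneg _)
      rw [map_sub, map_sub] at hℓrem
      have henv := le_envelope (C := ‖ℓ‖ * C) (K := K) hρ hη0 hη1
        (dualNorm_nonneg (p := p) (ℓ.comp (fderiv ℝ (fun w => h w θ) (x i))))
        (mul_nonneg (norm_nonneg ℓ) (hR.bound_nonneg (x i))) hs0 hτ0 h1 h2
      have hdiff : ℓ (h (x i) θ) - ℓ (h u θ)
          ≤ a i * τ + ‖ℓ‖ * b (x i) * (τ * min 1 τ) + ‖ℓ‖ * C * τ ^ ρ := by linarith
      have hmul := mul_le_mul_of_nonneg_left hdiff (by positivity : 0 ≤ ρ * s)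
      rw [hcost]
      simp only [hf, smul_apply, smul_eq_mul]
      rw [inv_mul_le_iff₀ hsρ, mul_add, mul_assoc (s ^ ρ)⁻¹, mul_inv_cancel_left₀ hsρ.ne']
      linarith)
  -- Finiteness matters here: `toReal` sends `∞` to zero, which would destroy a lower bound.
  have hne := profile_ne_top (q := q) (ρ := ρ) (x := x) (h := h) (θ := θ) hρ hn
    hR.integrable hR.integral_eq_zero hR.moment
  have hreal := (ENNReal.ofReal_le_iff_le_toReal hne).1 hle
  have hfin := mul_le_mul_of_nonneg_left hreal hsρ.le
  rw [← sqrt_rpow_eq]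
  refine le_trans (le_of_eq ?_) hfin
  simp only [hf, ha]
  rw [← Finset.mul_sum, map_smul, map_sum, Finset.sum_sub_distrib, ← Finset.mul_sum, hss, smul_eq_mul]
  field_simp

variable {Ω : Type*} [MeasurableSpace Ω] {μ : Measure Ω} [IsProbabilityMeasure μ]
  {X : ℕ → Ω → EuclideanSpace ℝ (Fin m)}

/-- The envelope parameters are fixed first. Both side conditions then hold for large `n` because `ρ
> 1`, and the strong law replaces the average envelope by its mean. -/
lemma eventually_profile_ge (hR : IsRegular p q ρ ν (fun w => h w θ) b C)
    (hindep : iIndepFun X μ) (hX : ∀ i, HasLaw (X i) ν μ)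
    (ℓ : EuclideanSpace ℝ (Fin r) →L[ℝ] ℝ) {ε : ℝ} (hε : 0 < ε) :
    ∀ᵐ ω ∂μ, ∀ᶠ n : ℕ in atTop,
      ρ * ℓ ((√(n : ℝ))⁻¹ • ∑ i ∈ Finset.range n, h (X i ω) θ)
        - conjugateCost p ρ ν (fderiv ℝ (fun w => h w θ)) ℓ - ε
      ≤ (n : ℝ) ^ (ρ / 2) * (profile q ρ h n (fun i => X i ω) θ).toReal := by
  have hρ := hR.one_lt
  obtain ⟨η, K, hη0, hη1, hm, hi, hlt⟩ := hR.exists_envelope_close ℓ hε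
  have hsqrt : Tendsto (fun n : ℕ => √(n : ℝ)) atTop atTop :=
    Real.tendsto_sqrt_atTop.comp tendsto_natCast_atTop_atTop
  have h1 : ∀ᶠ n : ℕ in atTop, ρ * (‖ℓ‖ * C) * √(n : ℝ) ≤ η * √(n : ℝ) ^ ρ := by
    have h3 : Tendsto (fun n : ℕ => η * √(n : ℝ) ^ (ρ - 1)) atTop atTop :=
      ((tendsto_rpow_atTop (by linarith : 0 < ρ - 1)).comp hsqrt).const_mul_atTop hη0
    filter_upwards [h3.eventually_ge_atTop (ρ * (‖ℓ‖ * C)), hsqrt.eventually_gt_atTop 0]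
      with n hn hpos
    have e : √(n : ℝ) ^ ρ = √(n : ℝ) ^ (ρ - 1) * √(n : ℝ) := by
      rw [← Real.rpow_add_one hpos.ne', sub_add_cancel]
    rw [e, ← mul_assoc η]
    exact mul_le_mul_of_nonneg_right hn hpos.le
  have h2 : ∀ᶠ n : ℕ in atTop, ρ * K ≤ (1 - η) * (η * √(n : ℝ)) ^ (ρ - 1) := by
    have h3 : Tendsto (fun n : ℕ => (1 - η) * (η * √(n : ℝ)) ^ (ρ - 1)) atTop atTop :=
      ((tendsto_rpow_atTop (by linarith : 0 < ρ - 1)).comp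
        (hsqrt.const_mul_atTop hη0)).const_mul_atTop (by linarith)
    exact h3.eventually_ge_atTop _
  filter_upwards [strong_law_sample hindep hX hm hi] with ω hω
  filter_upwards [h1, h2, hω.eventually_lt_const hlt, eventually_ge_atTop 1] with n hn1 hn2 hn3 hn
  have := profile_ge_of_envelope hR ℓ hn (fun i => X i ω) hη0 hη1 hn1 hn2
  rw [smul_eq_mul] at hn3
  linarith

end Asymptotics

/-! ### The asymptotic upper bound and the comparison on compact sets. -/

section UpperBound

variable {m l r : ℕ} {p q : ℝ≥0∞} [Fact (1 ≤ p)] [Fact (1 ≤ q)] {ρ : ℝ}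
  {ν : Measure (EuclideanSpace ℝ (Fin m))} [IsProbabilityMeasure ν]
  {h : EuclideanSpace ℝ (Fin m) → EuclideanSpace ℝ (Fin l) → EuclideanSpace ℝ (Fin r)}
  {θ : EuclideanSpace ℝ (Fin l)} {b : EuclideanSpace ℝ (Fin m) → ℝ} {C : ℝ}
  {g : EuclideanSpace ℝ (Fin m) → EuclideanSpace ℝ (Fin r)}

/-- A displacement of order `n^(-1/2)` has a Taylor remainder of order `b / n + n^(-ρ/2)`. Summing
`n` of these with the prefactor `n^(-1/2)` leaves a bound that vanishes when the averages of `b`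
converge, since `ρ > 1`. -/
lemma norm_sum_remainder_le (hR : IsRegular p q ρ ν g b C)
    {δ : EuclideanSpace ℝ (Fin m) → EuclideanSpace ℝ (Fin m)} {c : ℝ} (hc0 : 0 ≤ c)
    (hc : ∀ w, vecNorm q (δ w).ofLp ≤ c) {n : ℕ} (hn : 1 ≤ n)
    (x : ℕ → EuclideanSpace ℝ (Fin m)) :
    ‖((√(n : ℝ))⁻¹ • ∑ i ∈ Finset.range n, g (x i - (√(n : ℝ))⁻¹ • δ (x i))
        - (√(n : ℝ))⁻¹ • ∑ i ∈ Finset.range n, g (x i))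
        + (n : ℝ)⁻¹ • ∑ i ∈ Finset.range n, fderiv ℝ g (x i) (δ (x i))‖
      ≤ (√(n : ℝ))⁻¹ * (c ^ 2 * ((n : ℝ)⁻¹ * ∑ i ∈ Finset.range n, b (x i)))
        + C * c ^ ρ * (√(n : ℝ) ^ (ρ - 1))⁻¹ := by
  have hρ := hR.one_lt
  have hn' : (0 : ℝ) < n := by exact_mod_cast hn
  set s := √(n : ℝ) with hs
  have hs0 : 0 < s := Real.sqrt_pos.2 hn'
  have hss : (n : ℝ) = s * s := (Real.mul_self_sqrt hn'.le).symm
  have e1 : (s⁻¹ • ∑ i ∈ Finset.range n, g (x i - s⁻¹ • δ (x i))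
        - s⁻¹ • ∑ i ∈ Finset.range n, g (x i))
        + (n : ℝ)⁻¹ • ∑ i ∈ Finset.range n, fderiv ℝ g (x i) (δ (x i))
      = s⁻¹ • ∑ i ∈ Finset.range n, (g (x i + -(s⁻¹ • δ (x i))) - g (x i)
          - fderiv ℝ g (x i) (-(s⁻¹ • δ (x i)))) := by
    rw [← smul_sub, ← Finset.sum_sub_distrib, hss, mul_inv, mul_smul, ← smul_add, Finset.smul_sum,
      ← Finset.sum_add_distrib]
    congr 1
    refine Finset.sum_congr rfl fun i _ => ?_
    rw [map_neg, map_smul, sub_neg_eq_add, ← sub_eq_add_neg]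
  have hterm : ∀ i ∈ Finset.range n, ‖g (x i + -(s⁻¹ • δ (x i))) - g (x i)
      - fderiv ℝ g (x i) (-(s⁻¹ • δ (x i)))‖ ≤ b (x i) * (c ^ 2 * (n : ℝ)⁻¹) + C * (c / s) ^ ρ := by
    intro i _
    refine (hR.remainder_le _ _).trans ?_
    set τ := vecNorm q (-(s⁻¹ • δ (x i))).ofLp with hτ
    have hτ0 : 0 ≤ τ := vecNorm_nonneg q _
    have hτc : τ ≤ c / s := by
      rw [hτ, WithLp.ofLp_neg, vecNorm_neg, WithLp.ofLp_smul, vecNorm_smul,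
        abs_of_pos (inv_pos.2 hs0), div_eq_inv_mul]
      exact mul_le_mul_of_nonneg_left (hc _) (inv_pos.2 hs0).le
    have h1 : τ * min 1 τ ≤ c ^ 2 * (n : ℝ)⁻¹ := by
      have e2 : c ^ 2 * (n : ℝ)⁻¹ = (c / s) * (c / s) := by rw [hss]; field_simp
      rw [e2]
      exact mul_le_mul hτc ((min_le_right _ _).trans hτc) (le_min zero_le_one hτ0)
        (hτ0.trans hτc)
    have h2 : τ ^ ρ ≤ (c / s) ^ ρ := Real.rpow_le_rpow hτ0 hτc (by linarith)
    exact add_le_add (mul_le_mul_of_nonneg_left h1 (hR.bound_nonneg _))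
      (mul_le_mul_of_nonneg_left h2 hR.const_nonneg)
  rw [e1, norm_smul, Real.norm_of_nonneg (inv_pos.2 hs0).le]
  refine (mul_le_mul_of_nonneg_left ((norm_sum_le _ _).trans (Finset.sum_le_sum hterm))
    (inv_pos.2 hs0).le).trans (le_of_eq ?_)
  have e3 : s ^ ρ = s ^ (ρ - 1) * s := by
    rw [← Real.rpow_add_one hs0.ne', sub_add_cancel]
  have hsp : 0 < s ^ (ρ - 1) := Real.rpow_pos_of_pos hs0 _
  rw [Finset.sum_add_distrib, ← Finset.sum_mul, Finset.sum_const, Finset.card_range, nsmul_eq_mul,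
    Real.div_rpow hc0 hs0.le, e3]
  rw [hss]
  field_simp

variable {Ω : Type*} [MeasurableSpace Ω] {μ : Measure Ω} [IsProbabilityMeasure μ]
  {X : ℕ → Ω → EuclideanSpace ℝ (Fin m)}

lemma tendsto_perturbed_mean (hR : IsRegular p q ρ ν g b C) (hindep : iIndepFun X μ)
    (hX : ∀ i, HasLaw (X i) ν μ) (δ : boundedFields m) :
    ∀ᵐ ω ∂μ, Tendsto (fun n : ℕ =>
      (√(n : ℝ))⁻¹ • ∑ i ∈ Finset.range n, g (X i ω - (√(n : ℝ))⁻¹ • δ.1 (X i ω))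
        - (√(n : ℝ))⁻¹ • ∑ i ∈ Finset.range n, g (X i ω)) atTop
      (𝓝 (-meanEffect ν (fderiv ℝ g) hR.continuous_fderiv hR.integrable_norm_fderiv δ)) := by
  have hρ := hR.one_lt
  obtain ⟨hδ, c', hc'⟩ := δ.2
  obtain ⟨B, hB, hvec⟩ := exists_vecNorm_le_norm q m
  have hc0 : 0 ≤ B * c' := mul_nonneg hB.le ((norm_nonneg _).trans (hc' 0))
  have hc : ∀ w, vecNorm q (δ.1 w).ofLp ≤ B * c' := fun w =>
    (hvec _).trans (mul_le_mul_of_nonneg_left (hc' w) hB.le)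
  have hsqrt : Tendsto (fun n : ℕ => √(n : ℝ)) atTop atTop :=
    Real.tendsto_sqrt_atTop.comp tendsto_natCast_atTop_atTop
  have hlin := strong_law_sample hindep hX (measurable_apply_field hR.continuous_fderiv hδ)
    (integrable_apply_field hR.continuous_fderiv hR.integrable_norm_fderiv δ)
  filter_upwards [hlin, strong_law_sample hindep hX hR.measurable_bound hR.integrable_bound_one]
    with ω h1 h2
  simp only [smul_eq_mul] at h2
  have hbound : Tendsto (fun n : ℕ =>
      (√(n : ℝ))⁻¹ * ((B * c') ^ 2 * ((n : ℝ)⁻¹ * ∑ i ∈ Finset.range n, b (X i ω)))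
        + C * (B * c') ^ ρ * (√(n : ℝ) ^ (ρ - 1))⁻¹) atTop (𝓝 0) := by
    have h3 := (tendsto_inv_atTop_zero.comp hsqrt).mul (h2.const_mul ((B * c') ^ 2))
    have h4 := (tendsto_inv_atTop_zero.comp
      ((tendsto_rpow_atTop (by linarith : 0 < ρ - 1)).comp hsqrt)).const_mul (C * (B * c') ^ ρ)
    have h5 := h3.add h4
    rw [zero_mul, mul_zero, add_zero] at h5
    exact h5
  have hzero := squeeze_zero_norm' (by
    filter_upwards [eventually_ge_atTop 1] with n hn
    exact norm_sum_remainder_le hR hc0 hc hn fun i => X i ω) hbound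
  have h6 := hzero.sub h1
  rw [zero_sub] at h6
  refine h6.congr fun n => ?_
  rw [add_sub_cancel_right]

/-- A single near-optimal field solves the constraint only to first order. Near-optimal fields are
therefore chosen for the vertices of a simplex around `x₀`: the perturbed means then surround the
origin, and a mixture of the fields solves the constraint exactly at nearly the same cost. -/
lemma eventually_profile_le (hR : IsRegular p q ρ ν (fun w => h w θ) b C)
    (hindep : iIndepFun X μ) (hX : ∀ i, HasLaw (X i) ν μ) (x₀ : EuclideanSpace ℝ (Fin r)) {ε : ℝ}
    (hε : 0 < ε) :
    ∃ U ∈ 𝓝 x₀, ∀ᵐ ω ∂μ, ∀ᶠ n : ℕ in atTop,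
      (√(n : ℝ))⁻¹ • ∑ i ∈ Finset.range n, h (X i ω) θ ∈ U →
      (n : ℝ) ^ (ρ / 2) * (profile q ρ h n (fun i => X i ω) θ).toReal
        ≤ hR.limitFunction ((√(n : ℝ))⁻¹ • ∑ i ∈ Finset.range n, h (X i ω) θ) + ε := by
  have hρ := hR.one_lt
  have hcont := hR.continuous_limitFunction
  set G := hR.limitFunction with hG
  set T := meanEffect ν (fderiv ℝ fun w => h w θ) hR.continuous_fderiv hR.integrable_norm_fderiv
    with hT
  have hS : {y | G y < G x₀ + ε / 4} ∈ 𝓝 x₀ :=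
    (isOpen_lt hcont continuous_const).mem_nhds (by simp only [mem_ofPred_eq]; linarith)
  obtain ⟨β, hβ1, hβ2⟩ := exists_mem_interior_convexHull_affineBasis hS
  obtain ⟨η, hη, hball⟩ := Metric.nhds_basis_closedBall.mem_iff.1 (mem_interior_iff_mem_nhds.1 hβ1)
  have hδ : ∀ k, ∃ δ : boundedFields m, T δ = β k ∧ meanCost q ρ ν δ < G x₀ + ε / 4 := fun k =>
    exists_lt_of_valueFunction_lt hR.surjective (hβ2 (subset_convexHull ℝ _ (mem_range_self k)))
  choose δ hδT hδc using hδ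
  -- Half of the radius `η` is spent on the distance of the empirical mean from `x₀`, the other half
  -- on the Taylor error. The second set turns a bound by `G x₀` into one by `G` at the mean.
  refine ⟨Metric.ball x₀ (η / 2) ∩ {y | G x₀ - ε / 2 < G y}, inter_mem
    (Metric.ball_mem_nhds _ (half_pos hη)) ((isOpen_lt continuous_const hcont).mem_nhds
      (by simp only [mem_ofPred_eq]; linarith)), ?_⟩
  have hmean : ∀ᵐ ω ∂μ, ∀ k, Tendsto (fun n : ℕ =>
      (√(n : ℝ))⁻¹ • ∑ i ∈ Finset.range n, h (X i ω - (√(n : ℝ))⁻¹ • (δ k).1 (X i ω)) θ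
        - (√(n : ℝ))⁻¹ • ∑ i ∈ Finset.range n, h (X i ω) θ) atTop (𝓝 (-β k)) :=
    ae_all_iff.2 fun k => by
      rw [← hδT k]; exact tendsto_perturbed_mean hR hindep hX (δ k)
  have hcost : ∀ᵐ ω ∂μ, ∀ k, Tendsto (fun n : ℕ =>
      (n : ℝ)⁻¹ • ∑ i ∈ Finset.range n, vecNorm q ((δ k).1 (X i ω)).ofLp ^ ρ) atTop
      (𝓝 (meanCost q ρ ν (δ k))) :=
    ae_all_iff.2 fun k => strong_law_sample hindep hX (measurable_field_cost hρ (δ k).2.1)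
      (integrable_field_cost hρ (δ k))
  filter_upwards [hmean, hcost] with ω h1 h2
  have h1' : ∀ᶠ n : ℕ in atTop, ∀ k,
      ‖(√(n : ℝ))⁻¹ • ∑ i ∈ Finset.range n, h (X i ω - (√(n : ℝ))⁻¹ • (δ k).1 (X i ω)) θ
        - (√(n : ℝ))⁻¹ • ∑ i ∈ Finset.range n, h (X i ω) θ - -β k‖ < η / 2 :=
    eventually_all.2 fun k => by
      have := Metric.tendsto_nhds.1 (h1 k) (η / 2) (half_pos hη)
      simpa only [dist_eq_norm] using this
  have h2' : ∀ᶠ n : ℕ in atTop, ∀ k,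
      (n : ℝ)⁻¹ • ∑ i ∈ Finset.range n, vecNorm q ((δ k).1 (X i ω)).ofLp ^ ρ < G x₀ + ε / 4 :=
    eventually_all.2 fun k => (h2 k).eventually_lt_const (hδc k)
  filter_upwards [h1', h2', eventually_ge_atTop 1] with n hn1 hn2 hn hU
  obtain ⟨hU1, hU2⟩ := hU
  have hn' : (0 : ℝ) < n := by exact_mod_cast hn
  set s := √(n : ℝ) with hs
  have hs0 : 0 < s := Real.sqrt_pos.2 hn'
  have hsρ : 0 < s ^ ρ := Real.rpow_pos_of_pos hs0 _
  set Hn := s⁻¹ • ∑ i ∈ Finset.range n, h (X i ω) θ with hHn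
  set v := fun k => s⁻¹ • ∑ i ∈ Finset.range n, h (X i ω - s⁻¹ • (δ k).1 (X i ω)) θ with hv
  -- Equivalently, the origin is a convex combination of the perturbed means `v k`; the points `x₀ -
  -- v k` are close to the vertices `β k`.
  have hmem : x₀ ∈ convexHull ℝ (range fun k => x₀ - v k) := by
    refine mem_convexHull_of_perturbation hη hball fun k => ?_
    have h3 : ‖x₀ - Hn‖ < η / 2 := by rw [← dist_eq_norm, dist_comm]; exact hU1
    have e : x₀ - v k - β k = (x₀ - Hn) - (v k - Hn - -β k) := by abel
    rw [e]
    exact (norm_sub_le _ _).trans_lt (by linarith [hn1 k])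
  obtain ⟨ι, _, α, z, hα, hα1, hz, hzx⟩ := mem_convexHull_iff_exists_fintype.1 hmem
  choose σ hσ using hz
  have hzero : ∑ k, α k • ∑ i ∈ Finset.range n, h (X i ω - s⁻¹ • (δ (σ k)).1 (X i ω)) θ = 0 := by
    have h4 : ∑ k, α k • v (σ k) = 0 := by
      have : ∑ k, α k • z k = (∑ k, α k) • x₀ - ∑ k, α k • v (σ k) := by
        rw [Finset.sum_smul, ← Finset.sum_sub_distrib]
        refine Finset.sum_congr rfl fun k _ => ?_
        rw [← hσ k, smul_sub]
      rw [hzx, hα1, one_smul] at this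
      exact sub_eq_self.1 this.symm
    have h5 : s⁻¹ • ∑ k, α k • ∑ i ∈ Finset.range n, h (X i ω - s⁻¹ • (δ (σ k)).1 (X i ω)) θ
        = 0 := by
      rw [← h4, Finset.smul_sum]
      exact Finset.sum_congr rfl fun k _ => smul_comm _ _ _
    exact (smul_eq_zero.1 h5).resolve_left (inv_ne_zero hs0.ne')
  have hle := profile_le_of_convexCombination (q := q) (ρ := ρ) (h := h) (θ := θ)
    (x := fun i => X i ω) hρ hn hα hα1 hzero
  have hcosteq : ∀ w : EuclideanSpace ℝ (Fin m), ∀ k,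
      cost q ρ (w - s⁻¹ • (δ k).1 w) w = (s ^ ρ)⁻¹ * vecNorm q ((δ k).1 w).ofLp ^ ρ := by
    intro w k
    rw [cost, sub_sub_cancel_left, WithLp.ofLp_neg, vecNorm_neg, WithLp.ofLp_smul, vecNorm_smul,
      abs_of_pos (inv_pos.2 hs0), Real.mul_rpow (inv_pos.2 hs0).le (vecNorm_nonneg q _),
      Real.inv_rpow hs0.le]
  have hsum : ∑ k, α k * ((n : ℝ)⁻¹ * ∑ i ∈ Finset.range n,
        cost q ρ (X i ω - s⁻¹ • (δ (σ k)).1 (X i ω)) (X i ω))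
      ≤ (s ^ ρ)⁻¹ * (G x₀ + ε / 4) := by
    calc _ ≤ ∑ k, α k * ((s ^ ρ)⁻¹ * (G x₀ + ε / 4)) := by
          refine Finset.sum_le_sum fun k _ => mul_le_mul_of_nonneg_left ?_ (hα k)
          simp only [hcosteq]
          rw [← Finset.mul_sum, mul_left_comm]
          exact mul_le_mul_of_nonneg_left (hn2 (σ k)).le (inv_pos.2 hsρ).le
      _ = _ := by rw [← Finset.sum_mul, hα1, one_mul]
  have hnonneg : 0 ≤ ∑ k, α k * ((n : ℝ)⁻¹ * ∑ i ∈ Finset.range n,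
        cost q ρ (X i ω - s⁻¹ • (δ (σ k)).1 (X i ω)) (X i ω)) :=
    Finset.sum_nonneg fun k _ => mul_nonneg (hα k) (mul_nonneg (inv_pos.2 hn').le
      (Finset.sum_nonneg fun i _ => cost_nonneg _ _))
  have hreal := (ENNReal.toReal_le_of_le_ofReal hnonneg hle).trans hsum
  have hfin := mul_le_mul_of_nonneg_left hreal hsρ.le
  rw [mul_inv_cancel_left₀ hsρ.ne', hs, sqrt_rpow_eq] at hfin
  simp only [mem_ofPred_eq] at hU2
  linarith

/-- On compact sets the scaled profile function follows the limit function of the scaled mean. -/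
lemma eventually_profile_close (hR : IsRegular p q ρ ν (fun w => h w θ) b C)
    (hindep : iIndepFun X μ) (hX : ∀ i, HasLaw (X i) ν μ) {s : Set (EuclideanSpace ℝ (Fin r))}
    (hs : IsCompact s) {ε : ℝ} (hε : 0 < ε) :
    ∀ᵐ ω ∂μ, ∀ᶠ n : ℕ in atTop,
      (√(n : ℝ))⁻¹ • ∑ i ∈ Finset.range n, h (X i ω) θ ∈ s →
      |(n : ℝ) ^ (ρ / 2) * (profile q ρ h n (fun i => X i ω) θ).toReal
        - hR.limitFunction ((√(n : ℝ))⁻¹ • ∑ i ∈ Finset.range n, h (X i ω) θ)| ≤ ε := by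
  refine hs.induction_on (p := fun s => ∀ᵐ ω ∂μ, ∀ᶠ n : ℕ in atTop,
      (√(n : ℝ))⁻¹ • ∑ i ∈ Finset.range n, h (X i ω) θ ∈ s →
      |(n : ℝ) ^ (ρ / 2) * (profile q ρ h n (fun i => X i ω) θ).toReal
        - hR.limitFunction ((√(n : ℝ))⁻¹ • ∑ i ∈ Finset.range n, h (X i ω) θ)| ≤ ε)
    (by simp) (fun s t hst ht => ?_) (fun s t h1 h2 => ?_) fun x₀ _ => ?_
  · filter_upwards [ht] with ω hω
    filter_upwards [hω] with n hn hmem using hn (hst hmem)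
  · filter_upwards [h1, h2] with ω hω1 hω2
    filter_upwards [hω1, hω2] with n hn1 hn2 hmem
    exact hmem.elim hn1 hn2
  · obtain ⟨U, hU, hupper⟩ := eventually_profile_le hR hindep hX x₀ hε
    -- The affine dual bound of the maximising `ℓ` touches the limit function at `x₀`. By continuity
    -- it falls short by less than `ε / 2` nearby, so one multiplier serves a whole neighbourhood.
    obtain ⟨ℓ, hℓ⟩ := (hR.isGreatest_limitFunction x₀).1
    have hcont := hR.continuous_limitFunction
    have hV : {y | hR.limitFunction y - ε / 2
        < ρ * ℓ y - conjugateCost p ρ ν (fderiv ℝ fun w => h w θ) ℓ} ∈ 𝓝 x₀ := by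
      refine (isOpen_lt (hcont.sub continuous_const)
        ((continuous_const.mul ℓ.continuous).sub continuous_const)).mem_nhds ?_
      simp only [mem_ofPred_eq, Pi.sub_apply, Pi.mul_apply] at hℓ ⊢
      linarith
    refine ⟨_, mem_nhdsWithin_of_mem_nhds (inter_mem hU hV), ?_⟩
    filter_upwards [hupper, eventually_profile_ge hR hindep hX ℓ (half_pos hε)] with ω h1 h2
    filter_upwards [h1, h2] with n hn1 hn2 hmem
    have h3 := hn1 hmem.1
    have h4 := hmem.2
    simp only [mem_ofPred_eq] at h4
    rw [abs_le]
    exact ⟨by linarith, by linarith⟩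

end UpperBound

/-! ### From the assumptions to regularity. -/

section Assembly

variable {m l r : ℕ} {p q : ℝ≥0∞} [Fact (1 ≤ p)] [Fact (1 ≤ q)] {ρ : ℝ}
  {ν : Measure (EuclideanSpace ℝ (Fin m))} [IsProbabilityMeasure ν]

/-- The assumptions of the limit theorem make the estimating function regular. -/
lemma exists_isRegular (hpq : p⁻¹ + q⁻¹ = 1) (hρ : 1 < ρ)
    {g : EuclideanSpace ℝ (Fin m) → EuclideanSpace ℝ (Fin r)} (hC1 : ContDiff ℝ 1 g)
    (hmean : ∫ w, g w ∂ν = 0) (hsq : Integrable (fun w => ‖g w‖ ^ 2) ν)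
    (hnondeg : ∀ ζ : Fin r → ℝ, ζ ≠ 0 →
      0 < ν {w | 0 < vecNorm p (Matrix.vecMul ζ (jacobian g w))})
    {κ : ℝ} (hκ : 0 < κ)
    (hgrowth : ∀ w : EuclideanSpace ℝ (Fin m), 1 ≤ vecNorm q w.ofLp →
      matNorm p (jacobian g w) ≤ κ * vecNorm q w.ofLp ^ (ρ - 1))
    (hmoment : Integrable (fun w => vecNorm q w.ofLp ^ ρ) ν)
    {κbar : EuclideanSpace ℝ (Fin m) → ℝ} (hκm : Measurable κbar) (hκbar : ∀ w, 0 ≤ κbar w)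
    (hlip : ∀ w Δ : EuclideanSpace ℝ (Fin m), vecNorm q Δ.ofLp ≤ 1 →
      matNorm p (jacobian g (w + Δ) - jacobian g w) ≤ κbar w * vecNorm q Δ.ofLp)
    (hκint : Integrable (fun w => κbar w ^ max 2 (ρ / (ρ - 1))) ν) :
    ∃ b C, IsRegular p q ρ ν g b C := by
  have hs := one_lt_dualExponent hρ
  have hs0 : 0 ≤ ρ / (ρ - 1) := by linarith
  have hgm : Measurable g := hC1.continuous.measurable
  obtain ⟨C₀, hC₀, hder⟩ := exists_norm_fderiv_le (p := p) (q := q) hC1 hκ hgrowth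
  obtain ⟨C, hC, hrem⟩ := exists_remainder_le (p := p) (q := q) hρ hC1 hκ hgrowth hκbar hlip
  have hN0 : ∀ w : EuclideanSpace ℝ (Fin m), 0 ≤ vecNorm q w.ofLp ^ (ρ - 1) := fun w =>
    Real.rpow_nonneg (vecNorm_nonneg q _) _
  -- The growth exponent `ρ - 1` times the conjugate exponent is `ρ`, so the moment of order `ρ`
  -- controls the derivative.
  have hNpow : ∀ w : EuclideanSpace ℝ (Fin m),
      (vecNorm q w.ofLp ^ (ρ - 1)) ^ (ρ / (ρ - 1)) = vecNorm q w.ofLp ^ ρ := fun w => by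
    rw [← Real.rpow_mul (vecNorm_nonneg q _), mul_div_cancel₀ _ (by linarith : ρ - 1 ≠ 0)]
  have hNm : Measurable fun w : EuclideanSpace ℝ (Fin m) => vecNorm q w.ofLp ^ (ρ - 1) :=
    continuous_vecNorm_ofLp.measurable.pow_const _
  have h1N : ∀ w : EuclideanSpace ℝ (Fin m), (1 + vecNorm q w.ofLp ^ (ρ - 1)) ^ (ρ / (ρ - 1))
      ≤ 2 ^ (ρ / (ρ - 1)) * (1 + vecNorm q w.ofLp ^ ρ) := fun w => by
    have := rpow_add_le_two_mul zero_le_one (hN0 w) hs0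
    rwa [Real.one_rpow, hNpow] at this
  have hint : Integrable (fun w => 2 ^ (ρ / (ρ - 1)) * (1 + vecNorm q w.ofLp ^ ρ)) ν :=
    ((integrable_const 1).add hmoment).const_mul _
  have hκint' : Integrable (fun w => κbar w ^ (ρ / (ρ - 1))) ν := by
    refine Integrable.mono' ((integrable_const 1).add hκint)
      (hκm.pow_const _).aestronglyMeasurable (ae_of_all _ fun w => ?_)
    rw [Real.norm_of_nonneg (Real.rpow_nonneg (hκbar w) _)]
    simp only [Pi.add_apply]
    have h0 := Real.rpow_nonneg (hκbar w) (max 2 (ρ / (ρ - 1)))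
    rcases le_total (κbar w) 1 with h | h
    · linarith [Real.rpow_le_one (hκbar w) h hs0]
    · linarith [Real.rpow_le_rpow_of_exponent_le h (le_max_right 2 (ρ / (ρ - 1)))]
  refine ⟨fun w => C * (κbar w + 1 + vecNorm q w.ofLp ^ (ρ - 1)), C, ?_⟩
  have hb0 : ∀ w : EuclideanSpace ℝ (Fin m), 0 ≤ 1 + vecNorm q w.ofLp ^ (ρ - 1) := fun w => by
    linarith [hN0 w]
  have hbm : Measurable fun w : EuclideanSpace ℝ (Fin m) =>
      C * (κbar w + 1 + vecNorm q w.ofLp ^ (ρ - 1)) :=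
    ((hκm.add_const 1).add hNm).const_mul C
  refine
    { one_lt := hρ
      conjugate := hpq
      contDiff := hC1
      memLp_two := (memLp_two_iff_integrable_sq_norm hgm.aestronglyMeasurable).2 hsq
      integral_eq_zero := hmean
      moment := hmoment
      nondegenerate := ?_
      integrable_fderiv := ?_
      measurable_bound := hbm
      bound_nonneg := fun w => mul_nonneg hC.le (by linarith [hκbar w, hb0 w])
      integrable_bound := ?_
      const_nonneg := hC.le
      remainder_le := hrem }
  · intro ℓ hℓ
    obtain ⟨ζ, rfl⟩ := exists_eq_dotFunctional ℓ
    by_contra hne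
    have hζ : ζ ≠ 0 := by
      rintro rfl
      exact hne (ContinuousLinearMap.ext fun y => by simp [dotFunctional_apply])
    refine (hnondeg ζ hζ).ne' ?_
    refine measure_mono_null (fun w hw => ?_) (ae_iff.1 hℓ)
    simp only [mem_ofPred_eq] at hw ⊢
    intro h0
    rw [← dualNorm_dotFunctional_comp, h0] at hw
    have : dualNorm p (0 : EuclideanSpace ℝ (Fin m) →L[ℝ] ℝ) = 0 := vecNorm_zero p
    exact hw.ne' this
  · refine Integrable.mono' (hint.const_mul (C₀ ^ (ρ / (ρ - 1))))
      ((hC1.continuous_fderiv (by norm_num)).norm.measurable.pow_const _).aestronglyMeasurable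
      (ae_of_all _ fun w => ?_)
    rw [Real.norm_of_nonneg (by positivity)]
    refine (Real.rpow_le_rpow (norm_nonneg _) (hder w) hs0).trans ?_
    rw [Real.mul_rpow hC₀.le (hb0 w)]
    exact mul_le_mul_of_nonneg_left (h1N w) (by positivity)
  · refine Integrable.mono' (((hκint'.add hint).const_mul (2 ^ (ρ / (ρ - 1)))).const_mul
      (C ^ (ρ / (ρ - 1)))) (hbm.pow_const _).aestronglyMeasurable (ae_of_all _ fun w => ?_)
    have hk0 := hκbar w
    have hb0' := hb0 w
    have hsum0 : 0 ≤ κbar w + 1 + vecNorm q w.ofLp ^ (ρ - 1) := by linarith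
    rw [Real.norm_of_nonneg (Real.rpow_nonneg (mul_nonneg hC.le hsum0) _),
      Real.mul_rpow hC.le hsum0, add_assoc]
    refine mul_le_mul_of_nonneg_left ?_ (by positivity)
    refine (rpow_add_le_two_mul hk0 hb0' hs0).trans ?_
    refine mul_le_mul_of_nonneg_left ?_ (by positivity)
    simp only [Pi.add_apply]
    linarith [h1N w]

end Assembly

end RWP

/-! ### The limit theorem. -/

theorem mainTheorem2 {m l r : ℕ}
    {Ω₀ Ω Ω' : Type*} [MeasurableSpace Ω₀] [MeasurableSpace Ω] [MeasurableSpace Ω']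
    (μ₀ : Measure Ω₀) [IsProbabilityMeasure μ₀]
    (μ : Measure Ω) [IsProbabilityMeasure μ]
    (μ' : Measure Ω') [IsProbabilityMeasure μ']
    (p q : ℝ≥0∞) [Fact (1 ≤ p)] [Fact (1 ≤ q)] (hpq : p⁻¹ + q⁻¹ = 1)
    (ρ : ℝ) (hρ : 1 < ρ)
    (h : EuclideanSpace ℝ (Fin m) → EuclideanSpace ℝ (Fin l) → EuclideanSpace ℝ (Fin r))
    (θ : EuclideanSpace ℝ (Fin l))
    -- the population variable and the i.i.d. sample
    (W : Ω₀ → EuclideanSpace ℝ (Fin m)) (X : ℕ → Ω → EuclideanSpace ℝ (Fin m))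
    (hXindep : iIndepFun X μ) (hXident : ∀ i, IdentDistrib (X i) W μ μ₀)
    -- the estimating equation and the second moment of `h`
    (hmean : ∫ ω, h (W ω) θ ∂μ₀ = 0)
    (hsq : Integrable (fun ω => ‖h (W ω) θ‖ ^ 2) μ₀)
    -- smoothness
    (hC1 : ContDiff ℝ 1 (fun w => h w θ))
    -- nondegeneracy
    (hnondeg : ∀ ζ : Fin r → ℝ, ζ ≠ 0 →
      0 < μ₀ {ω | 0 < RWP.vecNorm p
        (Matrix.vecMul ζ (RWP.jacobian (fun w => h w θ) (W ω)))})
    -- growth condition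
    (κ : ℝ) (hκ : 0 < κ)
    (hgrowth : ∀ w : EuclideanSpace ℝ (Fin m), 1 ≤ RWP.vecNorm q w.ofLp →
      RWP.matNorm p (RWP.jacobian (fun w => h w θ) w) ≤ κ * RWP.vecNorm q w.ofLp ^ (ρ - 1))
    (hmoment : Integrable (fun ω => RWP.vecNorm q (W ω).ofLp ^ ρ) μ₀)
    -- local Lipschitz condition
    (κbar : EuclideanSpace ℝ (Fin m) → ℝ) (hκbar_meas : Measurable κbar)
    (hκbar_nonneg : ∀ w, 0 ≤ κbar w)
    (hlip : ∀ w Δ : EuclideanSpace ℝ (Fin m), RWP.vecNorm q Δ.ofLp ≤ 1 →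
      RWP.matNorm p (RWP.jacobian (fun w => h w θ) (w + Δ) - RWP.jacobian (fun w => h w θ) w)
        ≤ κbar w * RWP.vecNorm q Δ.ofLp)
    (hκbar_int : Integrable (fun ω => κbar (W ω) ^ max 2 (ρ / (ρ - 1))) μ₀)
    -- the Gaussian vector in the limit
    (H : Ω' → EuclideanSpace ℝ (Fin r))
    (hH : HasLaw H (multivariateGaussian 0 (RWP.secondMoment (fun w => h w θ) μ₀ W)) μ') :
    -- the profile function is finite
    (∀ n : ℕ, 1 ≤ n → ∀ ω, RWP.profile q ρ h n (fun i => X i ω) θ ≠ ∞) ∧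
    -- the limit variable is well defined: the expectations exist and the maximum is attained
    (∀ ζ : Fin r → ℝ, Integrable (fun ω => RWP.vecNorm p
      (Matrix.vecMul ζ (RWP.jacobian (fun w => h w θ) (W ω))) ^ (ρ / (ρ - 1))) μ₀) ∧
    (∀ x : EuclideanSpace ℝ (Fin r),
      IsGreatest (Set.range (RWP.limitObjective p ρ (fun w => h w θ) μ₀ W x))
        (RWP.limitValue p ρ (fun w => h w θ) μ₀ W x)) ∧
    -- weak convergence
    TendstoInDistribution
      (fun (n : ℕ) (ω : Ω) =>
        (n : ℝ) ^ (ρ / 2) * (RWP.profile q ρ h n (fun i => X i ω) θ).toReal)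
      atTop
      (fun ω' => RWP.limitValue p ρ (fun w => h w θ) μ₀ W (H ω'))
      (fun _ => μ) μ' := by
  have hWm : AEMeasurable W μ₀ := (hXident 0).aemeasurable_snd
  -- All hypotheses and the limit depend on `W` only through its law, so the argument runs on
  -- Euclidean space.
  set ν : Measure (EuclideanSpace ℝ (Fin m)) := μ₀.map W with hν
  have : IsProbabilityMeasure ν := Measure.isProbabilityMeasure_map hWm
  have hX : ∀ i, HasLaw (X i) ν μ := fun i => ⟨(hXident i).aemeasurable_fst, (hXident i).map_eq⟩
  set g : EuclideanSpace ℝ (Fin m) → EuclideanSpace ℝ (Fin r) := fun w => h w θ with hg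
  have hgc : Continuous g := hC1.continuous
  have hDc : Continuous (fderiv ℝ g) := hC1.continuous_fderiv (by norm_num)
  have hN : Continuous fun w : EuclideanSpace ℝ (Fin m) => RWP.vecNorm q w.ofLp :=
    RWP.continuous_vecNorm_ofLp
  have hJ : ∀ ζ : Fin r → ℝ, Continuous fun w =>
      RWP.vecNorm p (Matrix.vecMul ζ (RWP.jacobian g w)) := fun ζ => by
    have := RWP.continuous_dualNorm_comp (p := p) hDc (RWP.dotFunctional ζ)
    simpa only [RWP.dualNorm_dotFunctional_comp] using this
  have hrho : 0 ≤ ρ / (ρ - 1) := by linarith [RWP.one_lt_dualExponent hρ]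
  obtain ⟨b, C, hR⟩ : ∃ b C, RWP.IsRegular p q ρ ν g b C := by
    refine RWP.exists_isRegular hpq hρ hC1 ?_ ?_ (fun ζ hζ => ?_) hκ hgrowth ?_ hκbar_meas
      hκbar_nonneg hlip ?_
    · rw [hν, integral_map hWm hgc.aestronglyMeasurable]; exact hmean
    · exact (integrable_map_measure (hgc.norm.pow 2).aestronglyMeasurable hWm).2 hsq
    · rw [hν, Measure.map_apply_of_aemeasurable hWm (measurableSet_lt measurable_const
        (hJ ζ).measurable)]
      exact hnondeg ζ hζ
    · exact (integrable_map_measure (hN.measurable.pow_const ρ).aestronglyMeasurable hWm).2 hmoment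
    · exact (integrable_map_measure (hκbar_meas.pow_const _).aestronglyMeasurable hWm).2 hκbar_int
  have hJint : ∀ ζ : Fin r → ℝ, Integrable (fun w => RWP.vecNorm p
      (Matrix.vecMul ζ (RWP.jacobian g w)) ^ (ρ / (ρ - 1))) ν := fun ζ => by
    have := RWP.integrable_dualNorm_rpow (p := p) hrho hDc hR.integrable_fderiv (RWP.dotFunctional ζ)
    simpa only [RWP.dualNorm_dotFunctional_comp] using this
  have hobj : ∀ (x : EuclideanSpace ℝ (Fin r)) (ζ : Fin r → ℝ),
      RWP.limitObjective p ρ g μ₀ W x ζ = ρ * RWP.dotFunctional ζ x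
        - RWP.conjugateCost p ρ ν (fderiv ℝ g) (RWP.dotFunctional ζ) := fun x ζ => by
    rw [RWP.limitObjective, RWP.conjugateCost, RWP.dotFunctional_apply]
    simp only [RWP.dualNorm_dotFunctional_comp]
    rw [hν, integral_map hWm ((hJ ζ).measurable.pow_const _).aestronglyMeasurable]
  have hgreat : ∀ x : EuclideanSpace ℝ (Fin r),
      IsGreatest (Set.range (RWP.limitObjective p ρ g μ₀ W x)) (hR.limitFunction x) := fun x => by
    obtain ⟨⟨ℓ, hℓ⟩, hub⟩ := hR.isGreatest_limitFunction x
    refine ⟨?_, ?_⟩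
    · obtain ⟨ζ, rfl⟩ := RWP.exists_eq_dotFunctional ℓ
      exact ⟨ζ, (hobj x ζ).trans hℓ⟩
    · rintro _ ⟨ζ, rfl⟩
      rw [hobj]
      exact hub ⟨_, rfl⟩
  have hvalue : ∀ x, RWP.limitValue p ρ g μ₀ W x = hR.limitFunction x := fun x =>
    (hgreat x).csSup_eq
  refine ⟨fun n hn ω => RWP.profile_ne_top hρ hn hR.integrable hR.integral_eq_zero hR.moment,
    fun ζ => ?_, fun x => ?_, ?_⟩
  · exact (integrable_map_measure ((hJ ζ).measurable.pow_const _).aestronglyMeasurable hWm).1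
      (hJint ζ)
  · rw [hvalue]; exact hgreat x
  · simp only [hvalue]
    have hsm : RWP.secondMoment g μ₀ W = RWP.secondMoment g ν id := by
      ext i j
      simp only [RWP.secondMoment, Matrix.of_apply, id]
      rw [hν, integral_map hWm]
      exact Continuous.aestronglyMeasurable (by fun_prop)
    rw [hsm] at hH
    have hclt := RWP.central_limit_sample hXindep hX hgc.measurable hR.memLp_two
      hR.integral_eq_zero hH
    refine RWP.tendstoInDistribution_of_eventually_close hR.continuous_limitFunction hclt
      (fun n => ?_) fun R ε hε => ?_
    -- `measurable_profile` needs `n ≥ 1`; for `n = 0` the factor `0 ^ (ρ / 2)` makes the variable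
    -- zero.
    · rcases Nat.eq_zero_or_pos n with rfl | hn
      · simp only [Nat.cast_zero, Real.zero_rpow (by linarith : ρ / 2 ≠ 0), zero_mul]
        exact aemeasurable_const
      · have hpm := RWP.measurable_profile (m := m) (q := q) (ρ := ρ) (h := h) (θ := θ) hρ hn
        have hXm : AEMeasurable (fun ω i => X i ω) μ :=
          aemeasurable_pi_lambda _ fun i => (hX i).aemeasurable
        exact ((hpm.comp_aemeasurable hXm).ennreal_toReal).const_mul _
    · filter_upwards [RWP.eventually_profile_close hR hXindep hX
        (isCompact_closedBall (0 : EuclideanSpace ℝ (Fin r)) R) hε] with ω hω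
      filter_upwards [hω] with n hn hle
      exact hn (by simpa using hle)
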